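/- **Setting.** QPAlg processes are built from $\mathit{nil}$, $\mathit{end}$ (successful termination), prefix $\alpha.P$ (with $\alpha$ an emission $g\,!\,e$, a reception $g\,?\,x$, or the evaluation of an expression), declarations $[x_1{:}t_1,\dots,x_n{:}t_n\,.\,P]$ with types $\mathtt{Nat}$ (classical values) and $\mathtt{Qubit}$, $P\parallel Q$, $P+Q$, conditional choice $[c_1\to P_1,\dots,c_n\to P_n]$ (a nondeterministic choice among the $P_j$ with $c_j$ true), probabilistic choice $P\oplus_pQ$, restriction $P\backslash L$, sequential composition $P;Q$, and calls of (recursively) defined processes. $P;Q$ becomes $Q$, by an internal step, once $P$ has successfully terminated; $P\parallel Q$ terminates when both $P$ and $Q$ do; when a scope is left its variables are removed (qubits by partial trace). A process state is $P/C$, where $C=\langle s,q=\rho,f\rangle$ consists of a stack $s$ of declared variables (a cactus stack, because of $\parallel$), the list $q$ of initialized qubits with density matrix $\rho$, and the values $f$ of the classical variables, or $C=\boxplus_{p_i}C_i$ is probabilistic. Classical values are integers. Transitions are action transitions $S\xrightarrow{a}T$, with $a$ among $\tau$, the termination signal $\delta$, $g!v$, $g?v$ (values), $g!x$, $g?x$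 (qubits), and probabilistic transitions $S\xrightarrow{p}T$ with $p>0$, which are always solved first. The evaluation of $A[x_1\otimes\dots\otimes x_k]$, for a general measurement $A=\{A_\tau\}$ with $\sum_\tau A_\tau^\dagger A_\tau=1$, is an internal step to the probabilistic context in which, with probability $p_\tau=\mathrm{Tr}(A_\tau\rho A_\tau^\dagger)$, the memory is $A_\tau\rho A_\tau^\dagger/p_\tau$ and a fresh classical variable holds $\tau$. Reception $g?x$ of a qubit from the environment adds a qubit $x$ in any state $\nu$ (a density matrix) to the memory. In an internal communication, a value $v\in\{0,1\}$ sent to an uninitialized qubit initializes it to $|v\rangle\langle v|$. Measuring an observable $O$ with $O^2=1$ gives $\pm1$ with the projectors $(1\pm O)/2$. Silent transitions $S\leadsto T$ are the $\tau$-transitions and the probabilistic ones. For an equivalence relation $\mathcal R$ on states, a set $M$ and a state $S$, write $S\triangleright M$ if a sequence of transitions leads from $S$ to $M$ inside $M\cup[S]_{\mathcal R}$, and let $\mu_{\mathcal R}(S,M)$ be the probability to reach $M$ from $S$ without leaving $M\cup[S]_{\mathcal R}$, nondeterminism being treated as equiprobability: $\mu_{\mathcal R}(\cdot,M)$ is the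 least non-negative solution of: $\mu(S,M)=1$ if $S\in M$; else $\sum p_R\,\mu(R,M)$ over all $R\in M\cup[S]$ with $S\xrightarrow{p_R}R\triangleright M$, if there are any; else the average of $\mu(R,M)$ over all $R\in M\cup[S]$ with $S\xrightarrow{a}R\triangleright M$ for some action $a$, if there are any; else $0$. An equivalence relation $\mathcal B$ on process states is a *probabilistic branching bisimulation* if, whenever $S\,\mathcal B\,T$: (i) if $S\xrightarrow{a}S'$ with $a\in\{g!v,\,g?v,\,\delta\}$, there are $T\leadsto^*T'\xrightarrow{a}T''$ with $S\mathcal BT'$ and $S'\mathcal BT''$; (ii) if $S\xrightarrow{g!x}S'$ ($x$ a qubit), there are $y$ and $T\leadsto^*T'\xrightarrow{g!y}T''$ with $S\mathcal BT'$, $S'\mathcal BT''$, and the reduced state of $x$ in $S$ equal to that of $y$ in $T'$; (iii) the same for $g?x$, with equality of the reduced states of $x$ in $S'$ and of $y$ in $T''$; (iv) if $S\leadsto S'$, there are $T\leadsto^*T'$ and $T''$ with $T''=T'$ or $T'\leadsto T''$, $S\mathcal BT'$ and $S'\mathcal BT''$; (v) $\mu_{\mathcal B}(S,M)=\mu_{\mathcal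 B}(T,M)$ for every $\mathcal B$-class $M$. Two states are *bisimilar* if some such $\mathcal B$ relates them. **The processes.** With $H$ the Hadamard transformation, $$\mathit{Had}=[x{:}\mathtt{Qubit}\,.\;g?x\,.\,H[x]\,.\,h!x\,.\,\mathit{nil}].$$ Put $\mathit{Init}(y)=(p?y.\mathit{end}\parallel p!0.\mathit{end})\backslash\{p\}$, $\mathit{Transfer}(O_0,O_1;x,y,m,n)=(q_1!(O_0\otimes X)[x,y].\,q_2!O_1[x].\,\mathit{end}\parallel q_1?m.\,q_2?n.\,\mathit{end})\backslash\{q_1,q_2\}$, and $\mathit{Set}(c_0,c_1,c_2,c_3;i)=([c_0\to r!0.\mathit{end},\,c_1\to r!1.\mathit{end},\,c_2\to r!3.\mathit{end},\,c_3\to r!2.\mathit{end}]\parallel r?i.\mathit{end})\backslash\{r\}$. Then $$\begin{aligned}\mathit{SimulHad}=[\,y{:}\mathtt{Qubit},\,i{:}\mathtt{Nat}\,.\;&[\,x{:}\mathtt{Qubit},\,m,n{:}\mathtt{Nat}\,.\;g?x\,.\,(\mathit{Init}(y);\ \mathit{Transfer}(Z,X;x,y,m,n);\\&\ \mathit{Set}(m{=}1{\wedge}n{=}1,\;m{=}1{\wedge}n{=}{-}1,\;m{=}{-}1{\wedge}n{=}1,\;m{=}{-}1{\wedge}n{=}{-}1;\;i))]\,;\\&\sigma[i,y]\,;\;h!y\,.\,\mathit{nil}\,].\end{aligned}$$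 Here $\sigma$ is the recursive, measurement-based correction of the Pauli operator $\sigma_i$ ($\sigma_0=1$, $\sigma_1=X$, $\sigma_2=Y$, $\sigma_3=Z$): $\sigma[i,y]=[\,i{=}0\to\mathit{end},\ i{=}1\to P_1,\ i{=}2\to P_2,\ i{=}3\to P_3\,]$, where $P_k$ transfers the state of $y$ to an auxiliary qubit $z$ and transfers it back while simulating $\sigma_k$, up to a Pauli operator which is then corrected in its turn: $$\begin{aligned}P_k=[\,z{:}\mathtt{Qubit},\,m,n,m',n'{:}\mathtt{Nat}\,.\;&\mathit{Init}(z);\ \mathit{Transfer}(X,Z;y,z,m,n);\\&\mathit{Transfer}(\sigma_kX\sigma_k,\sigma_kZ\sigma_k;z,y,m',n');\\&\mathit{Set}(mm'{=}1{\wedge}n'{=}1,\;mm'{=}1{\wedge}n'{=}{-}1,\;mm'{=}{-}1{\wedge}n'{=}1,\;mm'{=}{-}1{\wedge}n'{=}{-}1;\;i)]\,;\ \sigma[i,y].\end{aligned}$$ **Theorem.** In the empty context $C_\emptyset$ (no declared variable, no qubit), the process states $\mathit{Had}/C_\emptyset$ and $\mathit{SimulHad}/C_\emptyset$ are probabilistic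 branching bisimilar. More precisely, there is a probabilistic branching bisimulation $\mathcal B$ with $(\mathit{Had}/C_\emptyset)\;\mathcal B\;(\mathit{SimulHad}/C_\emptyset)$ such that, moreover, from every state between the input and the output the class of the output is reached with probability $1$: if $S_0$ is one of the two initial states and $S_0\leadsto^*S_1\xrightarrow{g?x}S_2\leadsto^*S\leadsto^*S_3\xrightarrow{h!y}S_4$, then $\mu_{\mathcal B}(S,[S_4]_{\mathcal B})=1$. -/

import Mathlib

open scoped ENNReal Matrix ComplexConjugate ComplexOrder

namespace QPAlg

noncomputable section

/-! ### Admissible transformations (general quantum measurements) -/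

/-- Operators on a register of `k` qubits; a basis vector is a bit string `Fin k → Fin 2`. -/
abbrev Op (k : ℕ) : Type := Matrix (Fin k → Fin 2) (Fin k → Fin 2) ℂ

/-- An admissible transformation of dimension `k`: a finite family of operators `A_τ`, indexed by
classical outcomes `τ`, with `∑ A_τ† A_τ = 1`. -/
structure Admissible (k : ℕ) where
  outcomes : List ℤ
  nodup : outcomes.Nodup
  op : ℤ → Op k
  complete : (outcomes.map fun τ => (op τ)ᴴ * op τ).sum = 1

/-- The tensor product `M₀ ⊗ ⋯ ⊗ M_{k-1}` of one-qubit operators. -/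
def tensor {k : ℕ} (M : Fin k → Matrix (Fin 2) (Fin 2) ℂ) : Op k :=
  Matrix.of fun a b => ∏ j, M j (a j) (b j)

theorem tensor_mul {k : ℕ} (M N : Fin k → Matrix (Fin 2) (Fin 2) ℂ) :
    tensor M * tensor N = tensor fun j => M j * N j := by
  ext a b
  simp only [tensor, Matrix.mul_apply, Matrix.of_apply, ← Finset.prod_mul_distrib]
  exact (Fintype.prod_sum fun j c => M j (a j) c * N j c (b j)).symm

theorem tensor_one {k : ℕ} : tensor (fun _ : Fin k => (1 : Matrix (Fin 2) (Fin 2) ℂ)) = 1 := by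
  ext a b
  simp only [tensor, Matrix.of_apply, Matrix.one_apply]
  by_cases h : a = b
  · simp [h]
  · obtain ⟨j, hj⟩ := Function.ne_iff.mp h
    rw [if_neg h]
    exact Finset.prod_eq_zero (Finset.mem_univ j) (if_neg hj)

theorem tensor_conjTranspose {k : ℕ} (M : Fin k → Matrix (Fin 2) (Fin 2) ℂ) :
    (tensor M)ᴴ = tensor fun j => (M j)ᴴ := by
  ext a b
  simp [tensor, Matrix.conjTranspose_apply]

/-- A unitary transformation, as an admissible transformation with the single outcome `0`. -/
def unitary {k : ℕ} (U : Op k) (hU : Uᴴ * U = 1) : Admissible k where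
  outcomes := [0]
  nodup := by simp
  op _ := U
  complete := by simpa using hU

/-- One-qubit observables with eigenvalues in `{1, -1}`. -/
def Observable : Type := {M : Matrix (Fin 2) (Fin 2) ℂ // Mᴴ = M ∧ M * M = 1}

/-- The measurement of the observable `O₀ ⊗ ⋯ ⊗ O_{k-1}`: its outcomes are `1` and `-1`, and the
operator of the outcome `τ` is the eigenprojector `(1 + τ O₀ ⊗ ⋯ ⊗ O_{k-1}) / 2`. -/
def measure {k : ℕ} (O : Fin k → Observable) : Admissible k where
  outcomes := [1, -1]
  nodup := by decide
  op τ := (1 / 2 : ℂ) • (1 + (τ : ℂ) • tensor fun j => (O j).1)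
  complete := by
    have h1 : (tensor fun j => (O j).1)ᴴ = tensor fun j => (O j).1 := by
      rw [tensor_conjTranspose]; congr 1; funext j; exact (O j).2.1
    have h2 : (tensor fun j => (O j).1) * (tensor fun j => (O j).1) = 1 := by
      rw [tensor_mul, ← tensor_one]; congr 1; funext j; exact (O j).2.2
    have h3 : (starRingEnd ℂ) (1 / 2 : ℂ) = 1 / 2 := by simp [Complex.conj_ofNat]
    generalize (tensor fun j => (O j).1) = T at h1 h2
    have h4 : ∀ τ : ℤ, ((1 / 2 : ℂ) • (1 + (τ : ℂ) • T))ᴴ * ((1 / 2 : ℂ) • (1 + (τ : ℂ) • T)) =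
        (1 / 4 * (1 + (τ : ℂ) * τ)) • 1 + (1 / 2 * (τ : ℂ)) • T := by
      intro τ
      rw [Matrix.conjTranspose_smul, Matrix.conjTranspose_add, Matrix.conjTranspose_smul, h1,
        Matrix.conjTranspose_one, RCLike.star_def, h3, map_intCast]
      simp only [Matrix.smul_mul, Matrix.mul_smul, add_mul, mul_add, one_mul, mul_one, h2]
      module
    simp only [List.map_cons, List.map_nil, List.sum_cons, List.sum_nil, h4]
    push_cast
    module

def pauliX : Observable := ⟨!![0, 1; 1, 0], by
  constructor <;> ext i j <;> fin_cases i <;> fin_cases j <;> simp [Matrix.conjTranspose_apply]⟩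

def pauliZ : Observable := ⟨!![1, 0; 0, -1], by
  constructor <;> ext i j <;> fin_cases i <;> fin_cases j <;> simp [Matrix.conjTranspose_apply]⟩

/-- The observable `-O`. -/
def Observable.neg (O : Observable) : Observable :=
  ⟨-O.1, by rw [Matrix.conjTranspose_neg, O.2.1], by rw [neg_mul_neg, O.2.2]⟩

/-- The matrix `(1/√2) [[1, 1], [1, -1]]`. -/
def hadamardMatrix : Matrix (Fin 2) (Fin 2) ℂ :=
  ((Real.sqrt 2)⁻¹ : ℂ) • !![1, 1; 1, -1]

theorem hadamardMatrix_unitary : hadamardMatrixᴴ * hadamardMatrix = 1 := by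
  have h : ((Real.sqrt 2 : ℝ) : ℂ)⁻¹ * ((Real.sqrt 2 : ℝ) : ℂ)⁻¹ = (2 : ℂ)⁻¹ := by
    rw [← mul_inv, ← Complex.ofReal_mul, Real.mul_self_sqrt (by norm_num)]; norm_num
  ext i j
  fin_cases i <;> fin_cases j <;>
    simp [hadamardMatrix, Matrix.mul_apply, Matrix.conjTranspose_apply, h] <;> norm_num

/-- The Hadamard transformation. -/
def hadamard : Admissible 1 :=
  unitary (tensor ![hadamardMatrix]) (by
    rw [tensor_conjTranspose, tensor_mul, ← tensor_one]
    congr 1; funext j; fin_cases j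
    simpa using hadamardMatrix_unitary)

/-! ### Syntax -/

/-- Variable names. The names `prog n` are those which processes can declare; the names `res n` are
reserved for the fresh variables which hold the classical results of admissible transformations. -/
inductive Var
  | prog (n : ℕ)
  | res (n : ℕ)
  deriving DecidableEq

/-- The types of variables: classical values and qubits. -/
inductive Ty
  | nat
  | qubit
  deriving DecidableEq

abbrev Gate : Type := ℕ

inductive ArithOp
  | add
  | sub
  | mul
  | div

/-- The value of an arithmetic operation (undefined for a division by zero). -/
def ArithOp.eval : ArithOp → ℤ → ℤ → Option ℤ
  | .add, u, v => some (u + v)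
  | .sub, u, v => some (u - v)
  | .mul, u, v => some (u * v)
  | .div, u, v => if v = 0 then none else some (u / v)

/-- Expressions; `app A xs` is the application `A[x₁ ⊗ ⋯ ⊗ x_k]` of an admissible transformation to
a register of qubits. -/
inductive Exp : Type
  | val (v : ℤ)
  | var (x : Var)
  | app {k : ℕ} (A : Admissible k) (xs : Fin k → Var)
  | neg (e : Exp)
  | arith (o : ArithOp) (e₁ e₂ : Exp)

/-- Conditions on the values of the classical variables. -/
inductive Cond
  | eq (x : Var) (v : ℤ)
  | not (c : Cond)
  | and (c d : Cond)
  | or (c d : Cond)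

/-- `c.Holds f`: the condition `c` is true when the classical variables have the values `f`. -/
def Cond.Holds (f : Var → Option ℤ) : Cond → Prop
  | .eq x v => f x = some v
  | .not c => ¬ c.Holds f
  | .and c d => c.Holds f ∧ d.Holds f
  | .or c d => c.Holds f ∨ d.Holds f

/-- Basic actions: emission `g ! e`, reception `g ? x`, evaluation of an expression. -/
inductive Action : Type
  | send (g : Gate) (e : Exp)
  | recv (g : Gate) (x : Var)
  | expr (e : Exp)

/-- Process terms. -/
inductive Proc : Type
  /-- `nil` -/
  | nil
  /-- `end`, successful termination -/
  | fin
  /-- the prefix `α . P` -/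
  | act (α : Action) (P : Proc)
  /-- the declaration `[x₁ : t₁, …, xₙ : tₙ . P]` -/
  | decl (vs : List (ℕ × Ty)) (P : Proc)
  /-- `[P]`, the process `P` in the scope of variables which have been declared -/
  | scope (P : Proc)
  /-- `P ∥ Q` -/
  | par (P Q : Proc)
  /-- `P + Q` -/
  | sum (P Q : Proc)
  /-- the conditional `[c → P]` with one branch -/
  | guard (c : Cond) (P : Proc)
  /-- the probabilistic choice `P ⊕_p Q` -/
  | pchoice (p : unitInterval) (P Q : Proc)
  /-- the restriction `P \ L` -/
  | restrict (P : Proc) (L : List Gate)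
  /-- the sequential composition `P ; Q` -/
  | seq (P Q : Proc)
  /-- `name[a₁, …, aₙ]`, an instance of a named process -/
  | call (name : ℕ) (args : List Var)

/-- The conditional choice `[c₁ → P₁, …, cₙ → Pₙ]`, which behaves as a nondeterministic choice
between the `P_j` such that `c_j` is true. -/
def Proc.cond : List (Cond × Proc) → Proc
  | [] => .nil
  | (c, P) :: l => .sum (.guard c P) (Proc.cond l)

/-- Process definitions: `Δ name args` is the body of the process called `name`, its parameters
being replaced by the actual parameters `args`. -/
abbrev Defs : Type := ℕ → List Var → Proc

/-- Probabilistic stability `P↓`. -/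
inductive Stable (Δ : Defs) : Proc → Prop
  | nil : Stable Δ .nil
  | fin : Stable Δ .fin
  | act (α : Action) (P : Proc) : Stable Δ (.act α P)
  | decl (vs : List (ℕ × Ty)) (P : Proc) : Stable Δ (.decl vs P)
  | scope {P : Proc} : Stable Δ P → Stable Δ (.scope P)
  | par {P Q : Proc} : Stable Δ P → Stable Δ Q → Stable Δ (.par P Q)
  | sum {P Q : Proc} : Stable Δ P → Stable Δ Q → Stable Δ (.sum P Q)
  | guard {c : Cond} {P : Proc} : Stable Δ P → Stable Δ (.guard c P)
  | restrict {P : Proc} {L : List Gate} : Stable Δ P → Stable Δ (.restrict P L)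
  | seq {P Q : Proc} : Stable Δ P → Stable Δ (.seq P Q)
  | call {k : ℕ} {args : List Var} : Stable Δ (Δ k args) → Stable Δ (.call k args)

/-! ### Contexts -/

/-- A set of typed variables. -/
abbrev Frame : Type := List (Var × Ty)

/-- Environment stacks: `push e s` is `e . s`, and `fork s l r` is the cactus stack which consists of
the stack `s` with the two stacks `l` and `r`, put side by side, on top of it. -/
inductive Stack
  | empty
  | push (e : Frame) (s : Stack)
  | fork (s l r : Stack)

/-- All the variables in a stack, with their types. -/
def Stack.vars : Stack → Frame
  | .empty => []
  | .push e s => e ++ s.vars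
  | .fork s l r => l.vars ++ r.vars ++ s.vars

/-- Remove a variable from a stack. -/
def Stack.remove (x : Var) : Stack → Stack
  | .empty => .empty
  | .push e s => .push (e.filter fun v => v.1 ≠ x) (s.remove x)
  | .fork s l r => .fork (s.remove x) (l.remove x) (r.remove x)

/-- The decomposition of the stack of `P ∥ Q` into the part shared by `P` and `Q`, the part of `P` and
the part of `Q`. At the start, `P` and `Q` have each an empty set of variables of their own. -/
def Stack.split : Stack → Stack × Stack × Stack
  | .fork s l r => (s, l, r)
  | s => (s, .push [] .empty, .push [] .empty)

/-- Operators on the quantum memory, given by their matrix entries. A basis vector is labelled by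
the bits of the variables, so that the order of the qubits does not matter. Only the bits of the
variables that are in the memory are relevant: the entries do not depend on the others. -/
abbrev Memory : Type := Matrix (Var → Fin 2) (Var → Fin 2) ℂ

/-- The assignment `a`, where the bits of `xs` have been replaced by `c`. -/
def setBits {k : ℕ} (xs : Fin k → Var) (c : Fin k → Fin 2) (a : Var → Fin 2) : Var → Fin 2 :=
  (List.finRange k).foldl (fun b j => Function.update b (xs j) (c j)) a

/-- The super-operator `ρ ↦ A ρ A†`, where `A` acts on the qubits `xs`. -/
def Memory.applyOp {k : ℕ} (A : Op k) (xs : Fin k → Var) (ρ : Memory) : Memory :=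
  Matrix.of fun a b => ∑ c : Fin k → Fin 2, ∑ d : Fin k → Fin 2,
    A (fun j => a (xs j)) c * ρ (setBits xs c a) (setBits xs d b) *
      conj (A (fun j => b (xs j)) d)

/-- `ν ⊗ ρ`, where `ν` is the state of the qubit `x`, which is new in the memory. -/
def Memory.addQubit (x : Var) (ν : Matrix (Fin 2) (Fin 2) ℂ) (ρ : Memory) : Memory :=
  Matrix.of fun a b => ν (a x) (b x) * ρ a b

/-- The partial trace over the qubit `x` of the memory. -/
def Memory.traceOut (x : Var) (ρ : Memory) : Memory :=
  Matrix.of fun a b => ∑ t : Fin 2, ρ (Function.update a x t) (Function.update b x t)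

/-- The partial trace over the qubits in a list (of qubits in the memory). -/
def Memory.traceList (xs : List Var) (ρ : Memory) : Memory :=
  xs.foldr Memory.traceOut ρ

/-- The memory after the qubit `x` has been renamed to `y`. -/
def Memory.rename (x y : Var) (ρ : Memory) : Memory :=
  Matrix.of fun a b => ρ (Function.update a x (a y)) (Function.update b x (b y))

/-- Contexts `<s, q = ρ, f>`. -/
structure Ctx where
  stack : Stack
  qubits : List Var
  rho : Memory
  val : Var → Option ℤ

/-- The empty context: no variable at all, and the quantum memory without qubits, whose state is the
one-by-one density matrix `1`. -/
def emptyCtx : Ctx where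
  stack := .empty
  qubits := []
  rho := Matrix.of fun _ _ => 1
  val := fun _ => none

/-- The trace of the density matrix of a context. -/
def Ctx.trace (C : Ctx) : ℂ := C.rho.traceList C.qubits (fun _ => 0) (fun _ => 0)

/-- The state of the qubit `x`: the other qubits are traced out. -/
def Ctx.qubitState (C : Ctx) (x : Var) : Matrix (Fin 2) (Fin 2) ℂ :=
  Matrix.of fun s t => C.rho.traceList (C.qubits.filter fun z => z ≠ x) (fun _ => s) (fun _ => t)

/-- Remove the variables of `e` from the quantum memory (partial trace) and from the classical one,
and let `s` be the new stack. -/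
def Ctx.drop (e : Frame) (s : Stack) (C : Ctx) : Ctx where
  stack := s
  qubits := C.qubits.filter fun x => x ∉ e.map Prod.fst
  rho := C.rho.traceList (C.qubits.filter fun x => x ∈ e.map Prod.fst)
  val := fun x => if x ∈ e.map Prod.fst then none else C.val x

/-- The fresh variable in which the next result of an admissible transformation is stored. -/
def Ctx.fresh (C : Ctx) : Var := .res (sInf {k | C.val (.res k) = none})

/-- The unnormalized context after the outcome `τ` of the admissible transformation `A`. -/
def Ctx.apply {k : ℕ} (A : Admissible k) (xs : Fin k → Var) (τ : ℤ) (C : Ctx) : Ctx :=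
  { C with rho := C.rho.applyOp (A.op τ) xs }

/-- The probability of the outcome `τ`. -/
def Ctx.outcomeProb {k : ℕ} (A : Admissible k) (xs : Fin k → Var) (τ : ℤ) (C : Ctx) : ℝ :=
  (C.apply A xs τ).trace.re

/-- The context after the outcome `τ`; the set `e` on top of the stack `e . s` gets the fresh variable
whose value is `τ`. (An outcome of probability `0` gives no transition.) -/
def Ctx.afterOutcome {k : ℕ} (A : Admissible k) (xs : Fin k → Var) (τ : ℤ) (e : Frame) (s : Stack)
    (C : Ctx) : Ctx where
  stack := .push ((C.fresh, .nat) :: e) s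
  qubits := C.qubits
  rho := ((C.outcomeProb A xs τ : ℂ))⁻¹ • (C.apply A xs τ).rho
  val := Function.update C.val C.fresh (some τ)

/-- Contexts which may be probabilistic: a context `C` (stable), or `⊞_{p_i} C_i`. -/
inductive PCtx
  | pure (C : Ctx)
  | prob (l : List (ℝ × Ctx))

def PCtx.map (h : Ctx → Ctx) : PCtx → PCtx
  | .pure C => .pure (h C)
  | .prob l => .prob (l.map fun w => (w.1, h w.2))

/-- Replace each stack `s` by `h s`. -/
def PCtx.mapStack (h : Stack → Stack) : PCtx → PCtx :=
  PCtx.map fun C => { C with stack := h C.stack }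

/-! ### Evaluation of expressions -/

/-- `e / C ⟶ e' / D`: one step of evaluation, in any sub-expression of `e`. -/
inductive EvalStep (C : Ctx) : Exp → Exp → PCtx → Prop
  | var {x : Var} {v : ℤ} : C.val x = some v → EvalStep C (.var x) (.val v) (.pure C)
  | app {k : ℕ} (A : Admissible k) (xs : Fin k → Var) {e : Frame} {s : Stack} :
      C.stack = .push e s → (∀ j, xs j ∈ C.qubits) → Function.Injective xs →
      C.val C.fresh = none →
      EvalStep C (.app A xs) (.var C.fresh)
        (.prob (A.outcomes.map fun τ => (C.outcomeProb A xs τ, C.afterOutcome A xs τ e s)))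
  | negVal (v : ℤ) : EvalStep C (.neg (.val v)) (.val (-v)) (.pure C)
  | neg {e e' : Exp} {D : PCtx} : EvalStep C e e' D → EvalStep C (.neg e) (.neg e') D
  | arithVal {o : ArithOp} {u v w : ℤ} : o.eval u v = some w →
      EvalStep C (.arith o (.val u) (.val v)) (.val w) (.pure C)
  | arithL {o : ArithOp} {e e' d : Exp} {D : PCtx} : EvalStep C e e' D →
      EvalStep C (.arith o e d) (.arith o e' d) D
  | arithR {o : ArithOp} {e d d' : Exp} {D : PCtx} : EvalStep C d d' D →
      EvalStep C (.arith o e d) (.arith o e d') D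

/-! ### Action transitions -/

/-- The labels of action transitions: `τ`, the signal `δ` of successful termination, emission
`g ! v` and reception `g ? v` of a value, emission `g ! x` and reception `g ? x` of a qubit. -/
inductive Label
  | tau
  | term
  | sendVal (g : Gate) (v : ℤ)
  | recvVal (g : Gate) (v : ℤ)
  | sendQubit (g : Gate) (x : Var)
  | recvQubit (g : Gate) (x : Var)

/-- The gate which is used by an action. -/
def Label.gate : Label → Option Gate
  | .tau => none
  | .term => none
  | .sendVal g _ => some g
  | .recvVal g _ => some g
  | .sendQubit g _ => some g
  | .recvQubit g _ => some g

/-- Density matrices of dimension `2`. -/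
def IsDensity (ν : Matrix (Fin 2) (Fin 2) ℂ) : Prop := ν.PosSemidef ∧ ν.trace = 1

/-- `|v⟩⟨v|`, for `v = 0` or `v = 1`. -/
def basisState (v : ℤ) : Matrix (Fin 2) (Fin 2) ℂ :=
  Matrix.of fun i j => if ((i : ℕ) : ℤ) = v ∧ ((j : ℕ) : ℤ) = v then 1 else 0

/-- `Step Δ Γ P C α P' D`: the action transition from `P / C` to `P' / D`, labelled by `α`.

The environment stack is given in two parts: `C.stack` is the part that belongs to `P`, and `Γ` is the
list of the typed variables in the part below, which `P` shares with the processes in parallel and to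
which it can neither add nor remove variables. For a whole process state `Γ` is empty. -/
inductive Step (Δ : Defs) : Frame → Proc → Ctx → Label → Proc → PCtx → Prop
  -- evaluation of expressions
  | evalSend {Γ : Frame} {C : Ctx} {g : Gate} {e e' : Exp} {P : Proc} {D : PCtx} :
      EvalStep C e e' D →
      Step Δ Γ (.act (.send g e) P) C .tau (.act (.send g e') P) D
  | evalAct {Γ : Frame} {C : Ctx} {e e' : Exp} {P : Proc} {D : PCtx} :
      EvalStep C e e' D →
      Step Δ Γ (.act (.expr e) P) C .tau (.act (.expr e') P) D
  -- action prefix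
  | expr {Γ : Frame} {C : Ctx} (v : ℤ) (P : Proc) :
      Step Δ Γ (.act (.expr (.val v)) P) C .tau P (.pure C)
  | sendVal {Γ : Frame} {C : Ctx} (g : Gate) (v : ℤ) (P : Proc) :
      Step Δ Γ (.act (.send g (.val v)) P) C (.sendVal g v) P (.pure C)
  | sendQubit {Γ : Frame} {C : Ctx} (g : Gate) {x : Var} (P : Proc) :
      x ∈ C.qubits →
      Step Δ Γ (.act (.send g (.var x)) P) C (.sendQubit g x) P (.pure C)
  | recvVal {Γ : Frame} {C : Ctx} (g : Gate) {x : Var} (v : ℤ) (P : Proc) :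
      (x, Ty.nat) ∈ C.stack.vars ++ Γ →
      Step Δ Γ (.act (.recv g x) P) C (.recvVal g v) P
        (.pure { C with val := Function.update C.val x (some v) })
  | recvQubit {Γ : Frame} {C : Ctx} (g : Gate) {x : Var} {ν : Matrix (Fin 2) (Fin 2) ℂ} (P : Proc) :
      (x, Ty.qubit) ∈ C.stack.vars ++ Γ → x ∉ C.qubits → IsDensity ν →
      Step Δ Γ (.act (.recv g x) P) C (.recvQubit g x) P
        (.pure { C with qubits := x :: C.qubits, rho := C.rho.addQubit x ν })
  -- successful termination and sequential composition
  | fin {Γ : Frame} {C : Ctx} : Step Δ Γ .fin C .term .nil (.pure C)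
  | seq {Γ : Frame} {P P' : Proc} {C : Ctx} {α : Label} {D : PCtx} (Q : Proc) :
      Step Δ Γ P C α P' D → α ≠ .term →
      Step Δ Γ (.seq P Q) C α (.seq P' Q) D
  | seqTerm {Γ : Frame} {P P' : Proc} {C : Ctx} {D : PCtx} (Q : Proc) :
      Step Δ Γ P C .term P' D →
      Step Δ Γ (.seq P Q) C .tau Q D
  -- variable declaration; the variables disappear when the scope is left
  | decl {Γ : Frame} {C : Ctx} (vs : List (ℕ × Ty)) (P : Proc) :
      Step Δ Γ (.decl vs P) C .tau (.scope P)
        (.pure { C with stack := .push (vs.map fun v => (Var.prog v.1, v.2)) C.stack })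
  | scope {Γ : Frame} {P P' : Proc} {C : Ctx} {α : Label} {D : PCtx} :
      Step Δ Γ P C α P' D → α ≠ .term →
      Step Δ Γ (.scope P) C α (.scope P') D
  | scopeTerm {Γ : Frame} {P P' : Proc} {C C' : Ctx} {e : Frame} {s : Stack} :
      Step Δ Γ P C .term P' (.pure C') → C'.stack = .push e s →
      Step Δ Γ (.scope P) C .term .nil (.pure (C'.drop e s))
  | scopeNil {Γ : Frame} {C : Ctx} {e : Frame} {s : Stack} :
      C.stack = .push e s →
      Step Δ Γ (.scope .nil) C .tau .nil (.pure (C.drop e s))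
  -- nondeterministic choice, conditional, restriction, instances of named processes
  | sumL {Γ : Frame} {P P' Q : Proc} {C : Ctx} {α : Label} {D : PCtx} :
      Stable Δ P → Stable Δ Q → Step Δ Γ P C α P' D → Step Δ Γ (.sum P Q) C α P' D
  | sumR {Γ : Frame} {P Q Q' : Proc} {C : Ctx} {α : Label} {D : PCtx} :
      Stable Δ P → Stable Δ Q → Step Δ Γ Q C α Q' D → Step Δ Γ (.sum P Q) C α Q' D
  | guard {Γ : Frame} {c : Cond} {P P' : Proc} {C : Ctx} {α : Label} {D : PCtx} :
      c.Holds C.val → Step Δ Γ P C α P' D → Step Δ Γ (.guard c P) C α P' D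
  | restrict {Γ : Frame} {P P' : Proc} {L : List Gate} {C : Ctx} {α : Label} {D : PCtx} :
      Step Δ Γ P C α P' D → (∀ g ∈ L, α.gate ≠ some g) →
      Step Δ Γ (.restrict P L) C α (.restrict P' L) D
  | call {Γ : Frame} {k : ℕ} {args : List Var} {P' : Proc} {C : Ctx} {α : Label} {D : PCtx} :
      Step Δ Γ (Δ k args) C α P' D → Step Δ Γ (.call k args) C α P' D
  -- parallel composition
  | parL {Γ : Frame} {P P' Q : Proc} {C : Ctx} {s l r : Stack} {α : Label} {D : PCtx} :
      C.stack.split = (s, l, r) → Stable Δ P → Stable Δ Q → α ≠ .term →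
      Step Δ (s.vars ++ Γ) P { C with stack := l } α P' D →
      Step Δ Γ (.par P Q) C α (.par P' Q) (D.mapStack fun l' => .fork s l' r)
  | parR {Γ : Frame} {P Q Q' : Proc} {C : Ctx} {s l r : Stack} {α : Label} {D : PCtx} :
      C.stack.split = (s, l, r) → Stable Δ P → Stable Δ Q → α ≠ .term →
      Step Δ (s.vars ++ Γ) Q { C with stack := r } α Q' D →
      Step Δ Γ (.par P Q) C α (.par P Q') (D.mapStack fun r' => .fork s l r')
  -- `P ∥ Q` terminates when both `P` and `Q` do; their own variables disappear
  | parTerm {Γ : Frame} {P P' Q Q' : Proc} {C : Ctx} {s l r : Stack} {D₁ D₂ : PCtx} :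
      C.stack.split = (s, l, r) → Stable Δ P → Stable Δ Q →
      Step Δ (s.vars ++ Γ) P { C with stack := l } .term P' D₁ →
      Step Δ (s.vars ++ Γ) Q { C with stack := r } .term Q' D₂ →
      Step Δ Γ (.par P Q) C .term .nil (.pure (C.drop (l.vars ++ r.vars) s))
  -- communication of a classical value to a classical variable
  | commValL {Γ : Frame} {P P' Q Q' : Proc} {C C₂ : Ctx} {s l r : Stack} {D₁ : PCtx} {g : Gate}
      {v : ℤ} : C.stack.split = (s, l, r) → Stable Δ P → Stable Δ Q →
      Step Δ (s.vars ++ Γ) P { C with stack := l } (.sendVal g v) P' D₁ →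
      Step Δ (s.vars ++ Γ) Q { C with stack := r } (.recvVal g v) Q' (.pure C₂) →
      Step Δ Γ (.par P Q) C .tau (.par P' Q')
        (.pure { C with stack := .fork s l r, val := C₂.val })
  | commValR {Γ : Frame} {P P' Q Q' : Proc} {C C₂ : Ctx} {s l r : Stack} {D₁ : PCtx} {g : Gate}
      {v : ℤ} : C.stack.split = (s, l, r) → Stable Δ P → Stable Δ Q →
      Step Δ (s.vars ++ Γ) P { C with stack := l } (.recvVal g v) P' (.pure C₂) →
      Step Δ (s.vars ++ Γ) Q { C with stack := r } (.sendVal g v) Q' D₁ →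
      Step Δ Γ (.par P Q) C .tau (.par P' Q')
        (.pure { C with stack := .fork s l r, val := C₂.val })
  -- initialization of a qubit by a classical value
  | commInitL {Γ : Frame} {P P' Q Q' : Proc} {C : Ctx} {s l r : Stack} {D₁ D₂ : PCtx} {g : Gate}
      {v : ℤ} {y : Var} : C.stack.split = (s, l, r) → Stable Δ P → Stable Δ Q → v = 0 ∨ v = 1 →
      Step Δ (s.vars ++ Γ) P { C with stack := l } (.sendVal g v) P' D₁ →
      Step Δ (s.vars ++ Γ) Q { C with stack := r } (.recvQubit g y) Q' D₂ →
      Step Δ Γ (.par P Q) C .tau (.par P' Q')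
        (.pure { C with stack := .fork s l r, qubits := y :: C.qubits,
                        rho := C.rho.addQubit y (basisState v) })
  | commInitR {Γ : Frame} {P P' Q Q' : Proc} {C : Ctx} {s l r : Stack} {D₁ D₂ : PCtx} {g : Gate}
      {v : ℤ} {y : Var} : C.stack.split = (s, l, r) → Stable Δ P → Stable Δ Q → v = 0 ∨ v = 1 →
      Step Δ (s.vars ++ Γ) P { C with stack := l } (.recvQubit g y) P' D₂ →
      Step Δ (s.vars ++ Γ) Q { C with stack := r } (.sendVal g v) Q' D₁ →
      Step Δ Γ (.par P Q) C .tau (.par P' Q')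
        (.pure { C with stack := .fork s l r, qubits := y :: C.qubits,
                        rho := C.rho.addQubit y (basisState v) })
  -- communication of a qubit, which takes the name of the receiving variable
  | commQubitL {Γ : Frame} {P P' Q Q' : Proc} {C : Ctx} {s l r : Stack} {D₁ D₂ : PCtx} {g : Gate}
      {x y : Var} : C.stack.split = (s, l, r) → Stable Δ P → Stable Δ Q →
      (x, Ty.qubit) ∈ l.vars ++ s.vars →
      Step Δ (s.vars ++ Γ) P { C with stack := l } (.sendQubit g x) P' D₁ →
      Step Δ (s.vars ++ Γ) Q { C with stack := r } (.recvQubit g y) Q' D₂ →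
      Step Δ Γ (.par P Q) C .tau (.par P' Q')
        (.pure { C with stack := (Stack.fork s l r).remove x,
                        qubits := C.qubits.map fun z => if z = x then y else z,
                        rho := C.rho.rename x y })
  | commQubitR {Γ : Frame} {P P' Q Q' : Proc} {C : Ctx} {s l r : Stack} {D₁ D₂ : PCtx} {g : Gate}
      {x y : Var} : C.stack.split = (s, l, r) → Stable Δ P → Stable Δ Q →
      (x, Ty.qubit) ∈ r.vars ++ s.vars →
      Step Δ (s.vars ++ Γ) P { C with stack := l } (.recvQubit g y) P' D₂ →
      Step Δ (s.vars ++ Γ) Q { C with stack := r } (.sendQubit g x) Q' D₁ →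
      Step Δ Γ (.par P Q) C .tau (.par P' Q')
        (.pure { C with stack := (Stack.fork s l r).remove x,
                        qubits := C.qubits.map fun z => if z = x then y else z,
                        rho := C.rho.rename x y })

/-! ### Probabilistic transitions -/

/-- `Resolve Δ P d`: the process `P` is not stable, and its active probabilistic choices are resolved
according to the distribution `d` on processes (given as a finite weighted list). -/
inductive Resolve (Δ : Defs) : Proc → List (ℝ × Proc) → Prop
  | pchoice (p : unitInterval) (P Q : Proc) :
      Resolve Δ (.pchoice p P Q) [((p : ℝ), P), (1 - (p : ℝ), Q)]
  | sumL {P Q : Proc} {d : List (ℝ × Proc)} : Resolve Δ P d → Stable Δ Q →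
      Resolve Δ (.sum P Q) (d.map fun w => (w.1, .sum w.2 Q))
  | sumR {P Q : Proc} {d : List (ℝ × Proc)} : Stable Δ P → Resolve Δ Q d →
      Resolve Δ (.sum P Q) (d.map fun w => (w.1, .sum P w.2))
  | sumLR {P Q : Proc} {d d' : List (ℝ × Proc)} : Resolve Δ P d → Resolve Δ Q d' →
      Resolve Δ (.sum P Q) (d.flatMap fun w => d'.map fun w' => (w.1 * w'.1, .sum w.2 w'.2))
  | parL {P Q : Proc} {d : List (ℝ × Proc)} : Resolve Δ P d → Stable Δ Q →
      Resolve Δ (.par P Q) (d.map fun w => (w.1, .par w.2 Q))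
  | parR {P Q : Proc} {d : List (ℝ × Proc)} : Stable Δ P → Resolve Δ Q d →
      Resolve Δ (.par P Q) (d.map fun w => (w.1, .par P w.2))
  | parLR {P Q : Proc} {d d' : List (ℝ × Proc)} : Resolve Δ P d → Resolve Δ Q d' →
      Resolve Δ (.par P Q) (d.flatMap fun w => d'.map fun w' => (w.1 * w'.1, .par w.2 w'.2))
  | scope {P : Proc} {d : List (ℝ × Proc)} : Resolve Δ P d →
      Resolve Δ (.scope P) (d.map fun w => (w.1, .scope w.2))
  | guard {c : Cond} {P : Proc} {d : List (ℝ × Proc)} : Resolve Δ P d →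
      Resolve Δ (.guard c P) (d.map fun w => (w.1, .guard c w.2))
  | restrict {P : Proc} {L : List Gate} {d : List (ℝ × Proc)} : Resolve Δ P d →
      Resolve Δ (.restrict P L) (d.map fun w => (w.1, .restrict w.2 L))
  | seq {P Q : Proc} {d : List (ℝ × Proc)} : Resolve Δ P d →
      Resolve Δ (.seq P Q) (d.map fun w => (w.1, .seq w.2 Q))
  | call {k : ℕ} {args : List Var} {d : List (ℝ × Proc)} : Resolve Δ (Δ k args) d →
      Resolve Δ (.call k args) d

open Classical in
/-- The total weight that a finite weighted list gives to an element. -/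
def mass {α : Type} (l : List (ℝ × α)) (a : α) : ℝ :=
  (l.map fun w => if w.2 = a then w.1 else 0).sum

/-- Process states `P / C`, where the context `C` may be probabilistic. -/
structure State where
  proc : Proc
  ctx : PCtx

/-- The action transition `S -α→ T` between process states. -/
def Trans (Δ : Defs) (S : State) (α : Label) (T : State) : Prop :=
  ∃ C, S.ctx = .pure C ∧ Step Δ [] S.proc C α T.proc T.ctx

/-- The probabilistic transition `S -p→ T`. A probabilistic context must be resolved first, then the
probabilistic choices of the process. The number `p > 0` is the total probability of `T`. -/
inductive PTrans (Δ : Defs) : State → ℝ → State → Prop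
  | ctx (P : Proc) {l : List (ℝ × Ctx)} (C : Ctx) :
      (l.map Prod.fst).sum = 1 → 0 < mass l C →
      PTrans Δ ⟨P, .prob l⟩ (mass l C) ⟨P, .pure C⟩
  | proc {P : Proc} (C : Ctx) {d : List (ℝ × Proc)} (P' : Proc) :
      Resolve Δ P d → 0 < mass d P' →
      PTrans Δ ⟨P, .pure C⟩ (mass d P') ⟨P', .pure C⟩

/-! ### Probabilistic branching bisimulation -/

/-- Silent transitions `S ⇝ T`: internal transitions and probabilistic transitions. -/
def Silent (Δ : Defs) (S T : State) : Prop :=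
  Trans Δ S .tau T ∨ ∃ p, PTrans Δ S p T

/-- The state of the qubit `x` in a process state whose context is not probabilistic. -/
def State.qubitState (S : State) (x : Var) : Option (Matrix (Fin 2) (Fin 2) ℂ) :=
  match S.ctx with
  | .pure C => some (C.qubitState x)
  | .prob _ => none

/-- `S ▷ M`: there is a sequence of transitions from `S` to a state in `M` which remains in the union
of `M` and of the class of `S` for the equivalence relation `R`. -/
def Reaches (Δ : Defs) (R : State → State → Prop) (S : State) (M : Set State) : Prop :=
  ∃ T ∈ M, Relation.ReflTransGen
    (fun U V => ((∃ α, Trans Δ U α V) ∨ ∃ p, PTrans Δ U p V) ∧ (V ∈ M ∨ R S V)) S T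

/-- The probabilistic transitions that are taken into account in the computation of `μ_R (S, M)`. -/
def probSucc (Δ : Defs) (R : State → State → Prop) (M : Set State) (S : State) :
    Set (ℝ × State) :=
  {w | PTrans Δ S w.1 w.2 ∧ (w.2 ∈ M ∨ R S w.2) ∧ Reaches Δ R w.2 M}

/-- The targets of the action transitions that are taken into account in the computation of
`μ_R (S, M)`. -/
def actSucc (Δ : Defs) (R : State → State → Prop) (M : Set State) (S : State) : Set State :=
  {T | (∃ α, Trans Δ S α T) ∧ (T ∈ M ∨ R S T) ∧ Reaches Δ R T M}

open Classical in
/-- The right-hand side of the system of equations for `S ↦ μ_R (S, M)`: nondeterminism is treated as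
equiprobability. -/
def muStep (Δ : Defs) (R : State → State → Prop) (M : Set State) (h : State → ℝ≥0∞)
    (S : State) : ℝ≥0∞ :=
  if S ∈ M then 1
  else if (probSucc Δ R M S).Nonempty then
    ∑' w : probSucc Δ R M S, ENNReal.ofReal w.1.1 * h w.1.2
  else if (actSucc Δ R M S).Nonempty then
    (((actSucc Δ R M S).encard : ℝ≥0∞))⁻¹ * ∑' T : actSucc Δ R M S, h T.1
  else 0

/-- `μ_R (S, M)`, the probability to reach `M` from `S` without leaving the union of `M` and of the
class of `S`: the least solution of the system of equations, that is, the limit of the probabilities to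
reach `M` in fewer than `n` steps. -/
def mu (Δ : Defs) (R : State → State → Prop) (S : State) (M : Set State) : ℝ≥0∞ :=
  ⨆ n : ℕ, (muStep Δ R M)^[n] (fun _ => 0) S

/-- The equivalence relation `B` on process states is a probabilistic branching bisimulation. Two process
states are bisimilar if they are related by some probabilistic branching bisimulation. -/
structure IsBisimulation (Δ : Defs) (B : State → State → Prop) : Prop where
  equivalence : Equivalence B
  /-- emission of a value, reception of a value, termination signal -/
  sameLabel : ∀ S T S' α, (∃ g v, α = .sendVal g v ∨ α = .recvVal g v) ∨ α = .term →
    B S T → Trans Δ S α S' → ∃ T' T'', Relation.ReflTransGen (Silent Δ) T T' ∧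
      Trans Δ T' α T'' ∧ B S T' ∧ B S' T''
  sendQubit : ∀ S T S' g x, B S T → Trans Δ S (.sendQubit g x) S' →
    ∃ T' T'' y, Relation.ReflTransGen (Silent Δ) T T' ∧ Trans Δ T' (.sendQubit g y) T'' ∧
      S.qubitState x = T'.qubitState y ∧ B S T' ∧ B S' T''
  recvQubit : ∀ S T S' g x, B S T → Trans Δ S (.recvQubit g x) S' →
    ∃ T' T'' y, Relation.ReflTransGen (Silent Δ) T T' ∧ Trans Δ T' (.recvQubit g y) T'' ∧
      S'.qubitState x = T''.qubitState y ∧ B S T' ∧ B S' T''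
  silent : ∀ S T S', B S T → Silent Δ S S' →
    ∃ T' T'', Relation.ReflTransGen (Silent Δ) T T' ∧ (T' = T'' ∨ Silent Δ T' T'') ∧
      B S T' ∧ B S' T''
  probabilities : ∀ S T, B S T → ∀ U, mu Δ B S {V | B U V} = mu Δ B T {V | B U V}

/-! ### The Hadamard transformation and its simulation by measurements -/

abbrev gateG : Gate := 0
abbrev gateH : Gate := 1
abbrev gateP : Gate := 2
abbrev gateQ₁ : Gate := 3
abbrev gateQ₂ : Gate := 4
abbrev gateR : Gate := 5

/-- The variable names, in the order `x, y, z, i, m, n, m', n'`. -/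
abbrev vX : ℕ := 0
abbrev vY : ℕ := 1
abbrev vZ : ℕ := 2
abbrev vI : ℕ := 3
abbrev vM : ℕ := 4
abbrev vN : ℕ := 5
abbrev vM' : ℕ := 6
abbrev vN' : ℕ := 7

/-- `Had = [x : Qubit . g ? x . H[x] . h ! x . nil]`. -/
def had : Proc :=
  .decl [(vX, .qubit)] <|
    .act (.recv gateG (.prog vX)) <|
    .act (.expr (.app hadamard ![.prog vX])) <|
    .act (.send gateH (.var (.prog vX))) .nil

/-- `(p ? y . end ∥ p ! 0 . end) \ {p}`: the qubit `y` is initialized to `|0⟩`. -/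
def initQubit (y : Var) : Proc :=
  .restrict (.par (.act (.recv gateP y) .fin) (.act (.send gateP (.val 0)) .fin)) [gateP]

/-- `(q₁ ! (O₀ ⊗ X)[x, y] . q₂ ! O₁[x] . end ∥ q₁ ? m . q₂ ? n . end) \ {q₁, q₂}`. With
`O₀ = U† X U` and `O₁ = U† Z U` this is the step of state transfer from `x` to `y` which simulates `U`, up
to a Pauli operator that depends on the results `m` and `n`. -/
def transfer (O₀ O₁ : Observable) (x y m n : Var) : Proc :=
  .restrict (.par
    (.act (.send gateQ₁ (.app (measure ![O₀, pauliX]) ![x, y])) <|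
      .act (.send gateQ₂ (.app (measure ![O₁]) ![x])) .fin)
    (.act (.recv gateQ₁ m) <| .act (.recv gateQ₂ n) .fin)) [gateQ₁, gateQ₂]

/-- `([c₀ → r ! 0 . end, c₁ → r ! 1 . end, c₂ → r ! 3 . end, c₃ → r ! 2 . end] ∥ r ? i . end) \ {r}`: the
index `i` of the Pauli operator to be corrected is set according to the conditions
`c₀, c₁, c₂, c₃`. -/
def setIndex (c₀ c₁ c₂ c₃ : Cond) (i : Var) : Proc :=
  .restrict (.par
    (.cond [(c₀, .act (.send gateR (.val 0)) .fin), (c₁, .act (.send gateR (.val 1)) .fin),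
      (c₂, .act (.send gateR (.val 3)) .fin), (c₃, .act (.send gateR (.val 2)) .fin)])
    (.act (.recv gateR i) .fin)) [gateR]

/-- The condition that `m = u` and `n = v`. -/
def both (m : Var) (u : ℤ) (n : Var) (v : ℤ) : Cond := .and (.eq m u) (.eq n v)

/-- The condition that `m m' = w` and `n = v`, where `m` and `m'` are in `{1, -1}` and so is `w`. -/
def prodBoth (m m' : Var) (w : ℤ) (n : Var) (v : ℤ) : Cond :=
  .and (.or (both m 1 m' w) (both m (-1) m' (-w))) (.eq n v)

/-- The name of the process `σ`. -/
abbrev sigma : ℕ := 0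

/-- A step of simulation of the Pauli operator `σ_k` on the qubit `y`, followed by the correction
`σ[i, y]`. The observables are `O₀ = σ_k X σ_k` and `O₁ = σ_k Z σ_k`. The state of `y` is transferred to
an auxiliary qubit `z`, and then back to `y`, `σ_k` being simulated on the way back. -/
def pauliStep (O₀ O₁ : Observable) (i y : Var) : Proc :=
  .seq
    (.decl [(vZ, .qubit), (vM, .nat), (vN, .nat), (vM', .nat), (vN', .nat)] <|
      .seq (initQubit (.prog vZ)) <|
      .seq (transfer pauliX pauliZ y (.prog vZ) (.prog vM) (.prog vN)) <|
      .seq (transfer O₀ O₁ (.prog vZ) y (.prog vM') (.prog vN')) <|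
      setIndex (prodBoth (.prog vM) (.prog vM') 1 (.prog vN') 1)
        (prodBoth (.prog vM) (.prog vM') 1 (.prog vN') (-1))
        (prodBoth (.prog vM) (.prog vM') (-1) (.prog vN') 1)
        (prodBoth (.prog vM) (.prog vM') (-1) (.prog vN') (-1)) i)
    (.call sigma [i, y])

/-- `σ[i, y]`, the measurement-based simulation of the Pauli operator `σ_i` (where `σ₀ = 1`, `σ₁ = X`,
`σ₂ = Y`, `σ₃ = Z`) on the qubit `y`. -/
def sigmaBody (i y : Var) : Proc :=
  .cond [(.eq i 0, .fin),
    (.eq i 1, pauliStep pauliX pauliZ.neg i y),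
    (.eq i 2, pauliStep pauliX.neg pauliZ.neg i y),
    (.eq i 3, pauliStep pauliX.neg pauliZ i y)]

/-- The only named process is `σ`. -/
def hadDefs : Defs
  | 0, [i, y] => sigmaBody i y
  | _, _ => .nil

/-- The simulation of the Hadamard transformation by the measurements of `Z ⊗ X` and `X`, and the
correction `σ[i, y]`. -/
def simulHad : Proc :=
  .decl [(vY, .qubit), (vI, .nat)] <|
    .seq
      (.decl [(vX, .qubit), (vM, .nat), (vN, .nat)] <|
        .act (.recv gateG (.prog vX)) <|
        .seq (initQubit (.prog vY)) <|
        .seq (transfer pauliZ pauliX (.prog vX) (.prog vY) (.prog vM) (.prog vN)) <|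
        setIndex (both (.prog vM) 1 (.prog vN) 1) (both (.prog vM) 1 (.prog vN) (-1))
          (both (.prog vM) (-1) (.prog vN) 1) (both (.prog vM) (-1) (.prog vN) (-1)) (.prog vI)) <|
    .seq (.call sigma [.prog vI, .prog vY]) <|
    .act (.send gateH (.var (.prog vY))) .nil

/-- The state of a process in the empty context. -/
def initState (P : Proc) : State := ⟨P, .pure emptyCtx⟩

end

end QPAlg

namespace QPAlg

noncomputable section

/-! ### The probability to reach a set of states -/

section Mu

variable {Δ : Defs} {R : State → State → Prop} {M : Set State} {S T U : State}

theorem muStep_mono : Monotone (muStep Δ R M) := by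
  intro h k hk S
  unfold muStep
  split_ifs
  · exact le_rfl
  · exact ENNReal.tsum_le_tsum fun w => mul_le_mul_right (hk _) _
  · exact mul_le_mul_right (ENNReal.tsum_le_tsum fun w => hk _) _
  · exact le_rfl

theorem muStep_iterate_mono (S : State) :
    Monotone fun n : ℕ => (muStep Δ R M)^[n] (fun _ => 0) S := by
  intro m n h
  exact Monotone.monotone_iterate_of_le_map muStep_mono (fun _ => zero_le) h S

theorem mu_eq_iSup_muStep (S : State) :
    mu Δ R S M = ⨆ n : ℕ, muStep Δ R M ((muStep Δ R M)^[n] fun _ => 0) S := by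
  unfold mu
  rw [← sup_iSup_nat_succ]
  simp only [Function.iterate_succ_apply', Function.iterate_zero, id]
  exact sup_eq_right.mpr zero_le

theorem mu_of_mem (h : S ∈ M) : mu Δ R S M = 1 := by
  rw [mu_eq_iSup_muStep]
  simp [muStep, h]

/-- The only transition of `S` is an internal transition to `T`. -/
def Det (Δ : Defs) (S T : State) : Prop :=
  (∀ α V, Trans Δ S α V ↔ α = .tau ∧ V = T) ∧ ∀ p V, ¬ PTrans Δ S p V

/-- The only transitions of `S` are probabilistic, to `T` and to `U`, with the same probability. -/
def Flip (Δ : Defs) (S T U : State) : Prop :=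
  T ≠ U ∧ (∀ p V, PTrans Δ S p V ↔ p = 1 / 2 ∧ (V = T ∨ V = U)) ∧ ∀ α V, ¬ Trans Δ S α V

/-- The only transition of `S` is probabilistic, to `T`. -/
def Sure (Δ : Defs) (S T : State) : Prop :=
  (∀ p V, PTrans Δ S p V ↔ p = 1 ∧ V = T) ∧ ∀ α V, ¬ Trans Δ S α V

/-- A transition from `S` to `T`, of whatever kind. -/
def Next (Δ : Defs) (S T : State) : Prop := (∃ α, Trans Δ S α T) ∨ ∃ p, PTrans Δ S p T

theorem muStep_of_unique (hM : S ∉ M) (hp : ∀ p V, ¬ PTrans Δ S p V)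
    (hT : actSucc Δ R M S = {T}) (h : State → ℝ≥0∞) : muStep Δ R M h S = h T := by
  have h1 : ¬ (probSucc Δ R M S).Nonempty := fun ⟨w, hw⟩ => hp _ _ hw.1
  rw [muStep, if_neg hM, if_neg h1, if_pos (by simp [hT]), hT]
  simp

theorem actSucc_of_det (h : Det Δ S T) (hT : T ∈ M ∨ R S T) (hr : Reaches Δ R T M) :
    actSucc Δ R M S = {T} := by
  ext V
  simp only [actSucc, Set.mem_ofPred_eq, Set.mem_singleton_iff, h.1]
  constructor
  · rintro ⟨⟨_, _, rfl⟩, _⟩; rfl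
  · rintro rfl; exact ⟨⟨_, rfl, rfl⟩, hT, hr⟩

theorem muStep_of_flip (hM : S ∉ M) (h : Flip Δ S T U) (hT : T ∈ M ∨ R S T) (hU : U ∈ M ∨ R S U)
    (hrT : Reaches Δ R T M) (hrU : Reaches Δ R U M) (k : State → ℝ≥0∞) :
    muStep Δ R M k S = ENNReal.ofReal (1 / 2) * k T + ENNReal.ofReal (1 / 2) * k U := by
  classical
  have h1 : probSucc Δ R M S = (({((1 / 2 : ℝ), T), ((1 / 2 : ℝ), U)} : Finset (ℝ × State)) : Set _) := by
    ext ⟨p, V⟩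
    simp only [probSucc, Set.mem_ofPred_eq, h.2.1, Finset.coe_insert, Finset.coe_singleton,
      Set.mem_insert_iff, Set.mem_singleton_iff, Prod.mk.injEq]
    constructor
    · rintro ⟨⟨rfl, h⟩, _⟩; simpa using h
    · rintro (⟨rfl, rfl⟩ | ⟨rfl, rfl⟩)
      · exact ⟨⟨rfl, .inl rfl⟩, hT, hrT⟩
      · exact ⟨⟨rfl, .inr rfl⟩, hU, hrU⟩
  have h2 : (probSucc Δ R M S).Nonempty := by rw [h1]; exact ⟨(1 / 2, T), by simp⟩
  rw [muStep, if_neg hM, if_pos h2, h1,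
    Finset.tsum_subtype' _ fun w : ℝ × State => ENNReal.ofReal w.1 * k w.2,
    Finset.sum_pair (by simpa using h.1)]

theorem muStep_of_sure (hM : S ∉ M) (h : Sure Δ S T) (hT : T ∈ M ∨ R S T)
    (hr : Reaches Δ R T M) (k : State → ℝ≥0∞) : muStep Δ R M k S = k T := by
  classical
  have h1 : probSucc Δ R M S = (({((1 : ℝ), T)} : Finset (ℝ × State)) : Set _) := by
    ext ⟨p, V⟩
    simp only [probSucc, Set.mem_ofPred_eq, h.1, Finset.coe_singleton, Set.mem_singleton_iff,
      Prod.mk.injEq]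
    constructor
    · rintro ⟨h, _⟩; exact h
    · rintro ⟨rfl, rfl⟩; exact ⟨⟨rfl, rfl⟩, hT, hr⟩
  have h2 : (probSucc Δ R M S).Nonempty := by rw [h1]; exact ⟨(1, T), by simp⟩
  rw [muStep, if_neg hM, if_pos h2, h1,
    Finset.tsum_subtype' _ fun w : ℝ × State => ENNReal.ofReal w.1 * k w.2]
  simp

theorem mu_of_muStep_eq (h : ∀ k, muStep Δ R M k S = k T) : mu Δ R S M = mu Δ R T M := by
  rw [mu_eq_iSup_muStep]
  simp only [h]
  rfl

theorem mu_of_muStep_eq_add {a b : ℝ≥0∞} (h : ∀ k, muStep Δ R M k S = a * k T + b * k U) :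
    mu Δ R S M = a * mu Δ R T M + b * mu Δ R U M := by
  rw [mu_eq_iSup_muStep]
  simp only [h, mu, ENNReal.mul_iSup]
  rw [ENNReal.iSup_add_iSup_of_monotone]
  · exact fun m n hmn => mul_le_mul_right (muStep_iterate_mono T hmn) _
  · exact fun m n hmn => mul_le_mul_right (muStep_iterate_mono U hmn) _

/-- A set of states that no transition from the set `K` enters is reached from `K` with
probability `0`. -/
theorem mu_eq_zero {K : Set State} (hK : ∀ S ∈ K, ∀ T, R S T → T ∈ K)
    (hM : ∀ S ∈ K, S ∉ M) (hn : ∀ S ∈ K, ∀ T, Next Δ S T → T ∉ M) (hS : S ∈ K) :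
    mu Δ R S M = 0 := by
  have key : ∀ n : ℕ, ∀ S ∈ K, (muStep Δ R M)^[n] (fun _ => 0) S = 0 := by
    intro n
    induction n with
    | zero => intro S _; rfl
    | succ n ih =>
      intro S hS
      rw [Function.iterate_succ_apply', muStep, if_neg (hM S hS)]
      split_ifs
      · refine ENNReal.tsum_eq_zero.mpr fun w => ?_
        have h1 := hn S hS w.1.2 (.inr ⟨_, w.2.1⟩)
        rw [ih _ (hK S hS _ (w.2.2.1.resolve_left h1)), mul_zero]
      · rw [ENNReal.tsum_eq_zero.mpr fun w => ?_, mul_zero]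
        have h1 := hn S hS w.1 (.inl w.2.1)
        exact ih _ (hK S hS _ (w.2.2.1.resolve_left h1))
      · rfl
  simp only [mu, key _ S hS, iSup_const]

theorem Silent.next (h : Silent Δ S T) : Next Δ S T := h.imp (fun h => ⟨_, h⟩) id

theorem Det.silent (h : Det Δ S T) : Silent Δ S T := .inl ((h.1 _ _).2 ⟨rfl, rfl⟩)

theorem Flip.left (h : Flip Δ S T U) : Silent Δ S T := .inr ⟨_, (h.2.1 _ _).2 ⟨rfl, .inl rfl⟩⟩

theorem Flip.right (h : Flip Δ S T U) : Silent Δ S U := .inr ⟨_, (h.2.1 _ _).2 ⟨rfl, .inr rfl⟩⟩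

theorem Sure.silent (h : Sure Δ S T) : Silent Δ S T := .inr ⟨_, (h.1 _ _).2 ⟨rfl, rfl⟩⟩

end Mu

/-! ### Behavioural classes of states -/

/-- The density matrices of one qubit. -/
abbrev Density : Type := {ν : Matrix (Fin 2) (Fin 2) ℂ // IsDensity ν}

/-- The image of a matrix under the Hadamard transformation. -/
def hadamardConj (ν : Matrix (Fin 2) (Fin 2) ℂ) : Matrix (Fin 2) (Fin 2) ℂ :=
  hadamardMatrix * ν * hadamardMatrixᴴ

theorem hadamardConj_injective : Function.Injective hadamardConj := by
  have key : ∀ ν, hadamardMatrixᴴ * hadamardConj ν * hadamardMatrix = ν := by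
    intro ν
    have h := hadamardMatrix_unitary
    calc _ = (hadamardMatrixᴴ * hadamardMatrix) * ν * (hadamardMatrixᴴ * hadamardMatrix) := by
          simp only [hadamardConj, Matrix.mul_assoc]
      _ = ν := by simp [h]
  intro ν ν' h
  rw [← key ν, h, key]

/-- States which reach a state without transitions by internal transitions that are their only
transitions. -/
inductive Post (Δ : Defs) : State → Prop
  | stuck {S : State} : (∀ T, ¬ Next Δ S T) → Post Δ S
  | det {S T : State} : Det Δ S T → Post Δ T → Post Δ S

/-- The only transition of `S` is the emission at the gate `h` of a qubit in the state `ω`, and nothing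
happens afterwards. -/
def Sends (Δ : Defs) (ω : Matrix (Fin 2) (Fin 2) ℂ) (S : State) : Prop :=
  (∀ p V, ¬ PTrans Δ S p V) ∧ ∃ x T, (∀ α V, Trans Δ S α V ↔ α = .sendQubit gateH x ∧ V = T) ∧
    S.qubitState x = some ω ∧ Post Δ T

/-- The states from which finite probabilistic trees of internal transitions lead to states that emit
a qubit in the state `ω` and to states in `L`; `p` is the probability of the former. -/
inductive Tree (Δ : Defs) (L : Set State) (ω : Matrix (Fin 2) (Fin 2) ℂ) : ℝ → State → Prop
  | sends {S : State} : Sends Δ ω S → Tree Δ L ω 1 S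
  | loop {S : State} : S ∈ L → Tree Δ L ω 0 S
  | det {S T : State} {p : ℝ} : Det Δ S T → Tree Δ L ω p T → Tree Δ L ω p S
  | flip {S T U : State} {p q : ℝ} : Flip Δ S T U → Tree Δ L ω p T → Tree Δ L ω q U →
      Tree Δ L ω ((p + q) / 2) S
  | sure {S T : State} {p : ℝ} : Sure Δ S T → Tree Δ L ω p T → Tree Δ L ω p S

/-- From each state in `L`, an internal transition leads to a tree which ends with the emission of a
qubit in the state `ω` with probability `1/4`, and in `L` otherwise. -/
def IsLoop (Δ : Defs) (L : Set State) (ω : Matrix (Fin 2) (Fin 2) ℂ) : Prop :=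
  ∀ S ∈ L, ∃ T, Det Δ S T ∧ Tree Δ L ω (1 / 4) T

section Trees

variable {Δ : Defs} {L : Set State} {ω ω' : Matrix (Fin 2) (Fin 2) ℂ} {S T : State}

/-- The set of the states which are the root of a tree. -/
def Mid (Δ : Defs) (L : Set State) (ω : Matrix (Fin 2) (Fin 2) ℂ) : Set State :=
  {S | ∃ p, Tree Δ L ω p S}

theorem Post.trans (h : Post Δ S) {α : Label} (ht : Trans Δ S α T) : α = .tau ∧ Post Δ T := by
  cases h with
  | stuck h => exact (h _ (.inl ⟨_, ht⟩)).elim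
  | det h h' => obtain ⟨rfl, rfl⟩ := (h.1 _ _).1 ht; exact ⟨rfl, h'⟩

theorem Post.ptrans (h : Post Δ S) {p : ℝ} : ¬ PTrans Δ S p T := by
  cases h with
  | stuck h => exact fun ht => h _ (.inr ⟨_, ht⟩)
  | det h h' => exact h.2 _ _

theorem Post.silent (h : Post Δ S) (ht : Silent Δ S T) : Post Δ T := by
  rcases ht with ht | ⟨_, ht⟩
  exacts [(h.trans ht).2, (h.ptrans ht).elim]

theorem Post.silents (h : Post Δ S) (ht : Relation.ReflTransGen (Silent Δ) S T) : Post Δ T := by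
  induction ht with
  | refl => exact h
  | tail _ ht ih => exact ih.silent ht

theorem Mid.ptrans (hL : IsLoop Δ L ω) (h : S ∈ Mid Δ L ω) {p : ℝ} (ht : PTrans Δ S p T) :
    T ∈ Mid Δ L ω := by
  obtain ⟨q, h⟩ := h
  cases h with
  | sends h => exact (h.1 _ _ ht).elim
  | loop h => obtain ⟨_, h, _⟩ := hL _ h; exact (h.2 _ _ ht).elim
  | det h h' => exact (h.2 _ _ ht).elim
  | flip h h1 h2 =>
    obtain ⟨_, rfl | rfl⟩ := (h.2.1 _ _).1 ht
    exacts [⟨_, h1⟩, ⟨_, h2⟩]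
  | sure h h1 => obtain ⟨_, rfl⟩ := (h.1 _ _).1 ht; exact ⟨_, h1⟩

theorem Mid.trans (hL : IsLoop Δ L ω) (h : S ∈ Mid Δ L ω) {α : Label} (ht : Trans Δ S α T) :
    (α = .tau ∧ T ∈ Mid Δ L ω) ∨
      ∃ x, α = .sendQubit gateH x ∧ S.qubitState x = some ω ∧ Post Δ T := by
  obtain ⟨q, h⟩ := h
  cases h with
  | sends h =>
    obtain ⟨_, x, T', h, h1, h2⟩ := h
    obtain ⟨rfl, rfl⟩ := (h _ _).1 ht
    exact .inr ⟨x, rfl, h1, h2⟩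
  | loop h =>
    obtain ⟨_, h, h'⟩ := hL _ h
    obtain ⟨rfl, rfl⟩ := (h.1 _ _).1 ht
    exact .inl ⟨rfl, _, h'⟩
  | det h h' => obtain ⟨rfl, rfl⟩ := (h.1 _ _).1 ht; exact .inl ⟨rfl, _, h'⟩
  | flip h h1 h2 => exact (h.2.2 _ _ ht).elim
  | sure h h1 => exact (h.2 _ _ ht).elim

theorem Mid.silent (hL : IsLoop Δ L ω) (h : S ∈ Mid Δ L ω) (ht : Silent Δ S T) :
    T ∈ Mid Δ L ω := by
  rcases ht with ht | ⟨p, ht⟩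
  · rcases Mid.trans hL h ht with ⟨_, h⟩ | ⟨x, h, _⟩
    · exact h
    · cases h
  · exact Mid.ptrans hL h ht

theorem Mid.silents (hL : IsLoop Δ L ω) (h : S ∈ Mid Δ L ω)
    (ht : Relation.ReflTransGen (Silent Δ) S T) : T ∈ Mid Δ L ω := by
  induction ht with
  | refl => exact h
  | tail _ ht ih => exact Mid.silent hL ih ht

theorem Tree.exists_sends_or {p : ℝ} (h : Tree Δ L ω p S) :
    (∃ T, Relation.ReflTransGen (Silent Δ) S T ∧ Sends Δ ω T) ∨
      p = 0 ∧ ∃ T ∈ L, Relation.ReflTransGen (Silent Δ) S T := by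
  induction h with
  | sends h => exact .inl ⟨_, .refl, h⟩
  | loop h => exact .inr ⟨rfl, _, h, .refl⟩
  | det h _ ih =>
    exact ih.imp (fun ⟨T, h1, h2⟩ => ⟨T, .head h.silent h1, h2⟩)
      fun ⟨h0, T, h1, h2⟩ => ⟨h0, T, h1, .head h.silent h2⟩
  | sure h _ ih =>
    exact ih.imp (fun ⟨T, h1, h2⟩ => ⟨T, .head h.silent h1, h2⟩)
      fun ⟨h0, T, h1, h2⟩ => ⟨h0, T, h1, .head h.silent h2⟩
  | flip h _ _ ih1 ih2 =>
    rcases ih1 with ⟨T, h1, h2⟩ | ⟨h0, T, h1, h2⟩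
    · exact .inl ⟨T, .head h.left h1, h2⟩
    rcases ih2 with ⟨T, h1', h2'⟩ | ⟨h0', _⟩
    · exact .inl ⟨T, .head h.right h1', h2'⟩
    · exact .inr ⟨by rw [h0, h0']; norm_num, T, h1, .head h.left h2⟩

theorem Mid.exists_sends (hL : IsLoop Δ L ω) (h : S ∈ Mid Δ L ω) :
    ∃ T, Relation.ReflTransGen (Silent Δ) S T ∧ Sends Δ ω T := by
  obtain ⟨p, h⟩ := h
  rcases h.exists_sends_or with h | ⟨_, T, hT, h1⟩
  · exact h
  obtain ⟨U, h2, h3⟩ := hL T hT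
  rcases h3.exists_sends_or with ⟨V, h4, h5⟩ | ⟨h0, _⟩
  · exact ⟨V, h1.trans (.head h2.silent h4), h5⟩
  · norm_num at h0

theorem Mid.not_post (hL : IsLoop Δ L ω) (h : S ∈ Mid Δ L ω) : ¬ Post Δ S := by
  intro hp
  obtain ⟨T, h1, _, x, U, h2, _⟩ := Mid.exists_sends hL h
  cases ((hp.silents h1).trans ((h2 _ _).2 ⟨rfl, rfl⟩)).1

theorem Mid.state_unique {L' : Set State} (hL : IsLoop Δ L ω) (hL' : IsLoop Δ L' ω')
    (h : S ∈ Mid Δ L ω) (h' : S ∈ Mid Δ L' ω') : ω = ω' := by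
  obtain ⟨T, h1, _, x, U, h2, h3, _⟩ := Mid.exists_sends hL h
  rcases Mid.trans hL' (Mid.silents hL' h' h1) ((h2 _ _).2 ⟨rfl, rfl⟩) with ⟨h, _⟩ | ⟨y, h, h4, _⟩
  · cases h
  · cases h
    rw [h3] at h4
    exact Option.some_injective _ h4

/-! The probability to reach the states after the output. -/

variable {R : State → State → Prop}

theorem Mid.reaches (hL : IsLoop Δ L ω) (hR : ∀ S ∈ Mid Δ L ω, ∀ T ∈ Mid Δ L ω, R S T)
    (h : S ∈ Mid Δ L ω) : Reaches Δ R S {T | Post Δ T} := by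
  have key : ∀ T, Relation.ReflTransGen (Silent Δ) S T → Relation.ReflTransGen
      (fun U V => ((∃ α, Trans Δ U α V) ∨ ∃ p, PTrans Δ U p V) ∧ (V ∈ {T | Post Δ T} ∨ R S V))
      S T := by
    intro T h1
    induction h1 with
    | refl => exact .refl
    | tail h5 h6 ih =>
      exact .tail ih ⟨h6.next, .inr (hR _ h _ (Mid.silents hL h (h5.tail h6)))⟩
  obtain ⟨T, h1, _, x, U, h2, _, h4⟩ := Mid.exists_sends hL h
  exact ⟨U, h4, .tail (key T h1) ⟨.inl ⟨_, (h2 _ _).2 ⟨rfl, rfl⟩⟩, .inl h4⟩⟩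

theorem Post.reaches (h : Post Δ S) : Reaches Δ R S {T | Post Δ T} := ⟨S, h, .refl⟩

/-- One step of the computation of the probability to reach the states after the output. -/
theorem Tree.mu_eq (hL : IsLoop Δ L ω) (hR : ∀ S ∈ Mid Δ L ω, ∀ T ∈ Mid Δ L ω, R S T) :
    (∀ S, Sends Δ ω S → ∃ T, Post Δ T ∧ ∀ k, muStep Δ R {T | Post Δ T} k S = k T) ∧
    (∀ S T, Det Δ S T → S ∈ Mid Δ L ω → T ∈ Mid Δ L ω →
      ∀ k, muStep Δ R {T | Post Δ T} k S = k T) ∧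
    (∀ S T, Sure Δ S T → S ∈ Mid Δ L ω → T ∈ Mid Δ L ω →
      ∀ k, muStep Δ R {T | Post Δ T} k S = k T) ∧
    (∀ S T U, Flip Δ S T U → S ∈ Mid Δ L ω → T ∈ Mid Δ L ω → U ∈ Mid Δ L ω →
      ∀ k, muStep Δ R {T | Post Δ T} k S =
        ENNReal.ofReal (1 / 2) * k T + ENNReal.ofReal (1 / 2) * k U) := by
  refine ⟨?_, ?_, ?_, ?_⟩
  · intro S h
    have hS := Mid.not_post hL ⟨_, Tree.sends (L := L) h⟩
    obtain ⟨h0, x, T, h1, h2, h3⟩ := h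
    refine ⟨T, h3, muStep_of_unique hS h0 ?_⟩
    ext V
    simp only [actSucc, h1, Set.mem_ofPred_eq, Set.mem_singleton_iff]
    constructor
    · rintro ⟨⟨_, _, rfl⟩, _⟩; rfl
    · rintro rfl; exact ⟨⟨_, rfl, rfl⟩, .inl h3, h3.reaches⟩
  · intro S T h hS hT
    exact muStep_of_unique (Mid.not_post hL hS) h.2
      (actSucc_of_det h (.inr (hR _ hS _ hT)) (Mid.reaches hL hR hT))
  · intro S T h hS hT
    exact muStep_of_sure (Mid.not_post hL hS) h (.inr (hR _ hS _ hT)) (Mid.reaches hL hR hT)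
  · intro S T U h hS hT hU
    exact muStep_of_flip (Mid.not_post hL hS) h (.inr (hR _ hS _ hT)) (.inr (hR _ hS _ hU))
      (Mid.reaches hL hR hT) (Mid.reaches hL hR hU)

theorem half_mul_add_half_mul_le_one {a b : ℝ≥0∞} (ha : a ≤ 1) (hb : b ≤ 1) :
    ENNReal.ofReal (1 / 2) * a + ENNReal.ofReal (1 / 2) * b ≤ 1 := by
  calc _ ≤ ENNReal.ofReal (1 / 2) * 1 + ENNReal.ofReal (1 / 2) * 1 := by gcongr
    _ = 1 := by rw [mul_one, ← ENNReal.ofReal_add (by norm_num) (by norm_num)]; norm_num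

theorem muStep_of_post (h : Post Δ S) (k : State → ℝ≥0∞) :
    muStep Δ R {T | Post Δ T} k S = 1 := by
  rw [muStep, if_pos]; exact h

theorem Mid.mu_le_one (hL : IsLoop Δ L ω) (hR : ∀ S ∈ Mid Δ L ω, ∀ T ∈ Mid Δ L ω, R S T)
    (h : S ∈ Mid Δ L ω) : mu Δ R S {T | Post Δ T} ≤ 1 := by
  have hp : ∀ n T, Post Δ T → (muStep Δ R {T | Post Δ T})^[n] (fun _ => 0) T ≤ 1 := by
    intro n T hT
    cases n with
    | zero => exact zero_le
    | succ n => rw [Function.iterate_succ_apply', muStep_of_post hT]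
  obtain ⟨e1, e2, e3, e4⟩ := Tree.mu_eq hL hR
  have key : ∀ n, ∀ S ∈ Mid Δ L ω, (muStep Δ R {T | Post Δ T})^[n] (fun _ => 0) S ≤ 1 := by
    intro n
    induction n with
    | zero => intro S _; exact zero_le
    | succ n ih =>
      intro S hS
      rw [Function.iterate_succ_apply']
      have hS' := hS
      obtain ⟨p, hS'⟩ := hS'
      cases hS' with
      | sends h => obtain ⟨T, h1, h2⟩ := e1 _ h; rw [h2]; exact hp n T h1
      | loop h =>
        obtain ⟨T, h1, h2⟩ := hL _ h
        rw [e2 _ _ h1 hS ⟨_, h2⟩]; exact ih _ ⟨_, h2⟩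
      | det h h' => rw [e2 _ _ h hS ⟨_, h'⟩]; exact ih _ ⟨_, h'⟩
      | sure h h' => rw [e3 _ _ h hS ⟨_, h'⟩]; exact ih _ ⟨_, h'⟩
      | flip h h1 h2 =>
        rw [e4 _ _ _ h hS ⟨_, h1⟩ ⟨_, h2⟩]
        exact half_mul_add_half_mul_le_one (ih _ ⟨_, h1⟩) (ih _ ⟨_, h2⟩)
  exact iSup_le fun n => key n S h

/-- A lower bound on the probability from `L` gives one on the probability from a tree. -/
theorem Tree.le_mu (hL : IsLoop Δ L ω) (hR : ∀ S ∈ Mid Δ L ω, ∀ T ∈ Mid Δ L ω, R S T) {c p : ℝ}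
    (hc : ∀ S ∈ L, c ≤ (mu Δ R S {T | Post Δ T}).toReal) (h : Tree Δ L ω p S) :
    c + p * (1 - c) ≤ (mu Δ R S {T | Post Δ T}).toReal := by
  obtain ⟨e1, e2, e3, e4⟩ := Tree.mu_eq hL hR
  induction h with
  | sends h =>
    obtain ⟨T, h1, h2⟩ := e1 _ h
    rw [mu_of_muStep_eq h2, mu_of_mem (M := {T | Post Δ T}) h1]; simp
  | loop h => simpa using hc _ h
  | det h h' ih => rwa [mu_of_muStep_eq (e2 _ _ h ⟨_, .det h h'⟩ ⟨_, h'⟩)]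
  | sure h h' ih => rwa [mu_of_muStep_eq (e3 _ _ h ⟨_, .sure h h'⟩ ⟨_, h'⟩)]
  | flip h h1 h2 ih1 ih2 =>
    rw [mu_of_muStep_eq_add (e4 _ _ _ h ⟨_, .flip h h1 h2⟩ ⟨_, h1⟩ ⟨_, h2⟩), ENNReal.toReal_add,
      ENNReal.toReal_mul, ENNReal.toReal_mul, ENNReal.toReal_ofReal (by norm_num)]
    · linarith
    · exact ENNReal.mul_ne_top ENNReal.ofReal_ne_top
        (ne_top_of_le_ne_top ENNReal.one_ne_top (Mid.mu_le_one hL hR ⟨_, h1⟩))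
    · exact ENNReal.mul_ne_top ENNReal.ofReal_ne_top
        (ne_top_of_le_ne_top ENNReal.one_ne_top (Mid.mu_le_one hL hR ⟨_, h2⟩))

theorem Mid.mu_eq_one (hL : IsLoop Δ L ω) (hR : ∀ S ∈ Mid Δ L ω, ∀ T ∈ Mid Δ L ω, R S T)
    (h : S ∈ Mid Δ L ω) : mu Δ R S {T | Post Δ T} = 1 := by
  set f : State → ℝ := fun S => (mu Δ R S {T | Post Δ T}).toReal with hf
  have h1 : ∀ S ∈ L, 1 ≤ f S := by
    intro S hS
    have hb : BddBelow (f '' L) := ⟨0, by rintro _ ⟨T, _, rfl⟩; exact ENNReal.toReal_nonneg⟩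
    have hc : ∀ S ∈ L, sInf (f '' L) ≤ f S := fun S hS => csInf_le hb ⟨S, hS, rfl⟩
    have h2 : sInf (f '' L) + 1 / 4 * (1 - sInf (f '' L)) ≤ sInf (f '' L) := by
      refine le_csInf ⟨_, S, hS, rfl⟩ ?_
      rintro _ ⟨T, hT, rfl⟩
      obtain ⟨U, h3, h4⟩ := hL T hT
      have := Tree.le_mu hL hR hc h4
      rwa [← mu_of_muStep_eq ((Tree.mu_eq hL hR).2.1 _ _ h3 ⟨_, .loop hT⟩ ⟨_, h4⟩)] at this
    have := hc S hS
    linarith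
  have h2 := Mid.mu_le_one hL hR h
  obtain ⟨p, h⟩ := h
  have h3 := Tree.le_mu hL hR h1 h
  refine le_antisymm h2 ?_
  rw [sub_self, mul_zero, add_zero] at h3
  rw [← ENNReal.ofReal_toReal (ne_top_of_le_ne_top ENNReal.one_ne_top h2), ← ENNReal.ofReal_one]
  exact ENNReal.ofReal_le_ofReal h3

end Trees

/-! ### The bisimulation -/

/-- The only transitions of `S` are the receptions of a qubit at the gate `g`; after the reception of
the state `ν`, the state `hadamardConj ν` is emitted. -/
def Receives (Δ : Defs) (L : Density → Set State) (S : State) : Prop :=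
  (∀ p V, ¬ PTrans Δ S p V) ∧ ∃ (x : Var) (F : Density → State),
    (∀ α V, Trans Δ S α V ↔ ∃ ν, α = .recvQubit gateG x ∧ V = F ν) ∧
    ∀ ν, F ν ∈ Mid Δ (L ν) (hadamardConj ν.1) ∧ (F ν).qubitState x = some ν.1

/-- States which reach a state that is waiting for the input, by internal transitions that are their
only transitions. -/
inductive Pre (Δ : Defs) (L : Density → Set State) : State → Prop
  | recv {S : State} : Receives Δ L S → Pre Δ L S
  | det {S T : State} : Det Δ S T → Pre Δ L T → Pre Δ L S

/-- The phases of the computation: before the input, between the input of `ν` and the output, after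
the output. -/
inductive Phase
  | pre
  | mid (ν : Density)
  | post

/-- The states in a phase of the computation. -/
def phase (Δ : Defs) (L : Density → Set State) : Phase → Set State
  | .pre => {S | Pre Δ L S}
  | .mid ν => Mid Δ (L ν) (hadamardConj ν.1)
  | .post => {S | Post Δ S}

/-- Equality, or being in the same phase of the computation. -/
def SamePhase (Δ : Defs) (L : Density → Set State) (S T : State) : Prop :=
  S = T ∨ ∃ c, S ∈ phase Δ L c ∧ T ∈ phase Δ L c

section Bisimulation

variable {Δ : Defs} {L : Density → Set State} {S T U : State} {c d : Phase}

theorem Pre.ptrans (h : Pre Δ L S) {p : ℝ} : ¬ PTrans Δ S p T := by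
  cases h with
  | recv h => exact h.1 _ _
  | det h => exact h.2 _ _

theorem Pre.trans (h : Pre Δ L S) {α : Label} (ht : Trans Δ S α T) :
    (α = .tau ∧ Pre Δ L T) ∨ ∃ x ν, α = .recvQubit gateG x ∧
      T ∈ phase Δ L (.mid ν) ∧ T.qubitState x = some ν.1 := by
  cases h with
  | recv h =>
    obtain ⟨_, x, F, h, h1⟩ := h
    obtain ⟨ν, rfl, rfl⟩ := (h _ _).1 ht
    exact .inr ⟨x, ν, rfl, (h1 ν).1, (h1 ν).2⟩
  | det h h' => obtain ⟨rfl, rfl⟩ := (h.1 _ _).1 ht; exact .inl ⟨rfl, h'⟩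

theorem Pre.silent (h : Pre Δ L S) (ht : Silent Δ S T) : Pre Δ L T := by
  rcases ht with ht | ⟨p, ht⟩
  · rcases h.trans ht with ⟨_, h⟩ | ⟨x, _, h, _⟩
    · exact h
    · cases h
  · exact (h.ptrans ht).elim

theorem Pre.silents (h : Pre Δ L S) (ht : Relation.ReflTransGen (Silent Δ) S T) : Pre Δ L T := by
  induction ht with
  | refl => exact h
  | tail _ ht ih => exact ih.silent ht

theorem Pre.exists_receives (h : Pre Δ L S) :
    ∃ T, Relation.ReflTransGen (Silent Δ) S T ∧ Receives Δ L T := by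
  induction h with
  | recv h => exact ⟨_, .refl, h⟩
  | det h _ ih => obtain ⟨T, h1, h2⟩ := ih; exact ⟨T, .head h.silent h1, h2⟩

theorem Pre.not_post (h : Pre Δ L S) (hp : Post Δ S) : False := by
  induction h with
  | recv h =>
    obtain ⟨_, x, F, h, _⟩ := h
    have ν : Density := ⟨Matrix.diagonal ![1, 0], by
      constructor
      · refine Matrix.PosSemidef.diagonal fun i => ?_
        fin_cases i <;> simp
      · simp [Matrix.trace, Fin.sum_univ_two]⟩
    cases (hp.trans ((h _ _).2 ⟨ν, rfl, rfl⟩)).1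
  | det h _ ih => exact ih (hp.trans ((h.1 _ _).2 ⟨rfl, rfl⟩)).2

theorem Pre.not_mid {L' : Set State} {ω : Matrix (Fin 2) (Fin 2) ℂ} (hL : IsLoop Δ L' ω)
    (h : Pre Δ L S) (hm : S ∈ Mid Δ L' ω) : False := by
  obtain ⟨T, h1, h2⟩ := Mid.exists_sends hL hm
  obtain ⟨_, x, U, h2, _⟩ := h2
  rcases (h.silents h1).trans ((h2 _ _).2 ⟨rfl, rfl⟩) with ⟨h, _⟩ | ⟨x, _, h, _⟩ <;> cases h

theorem phase_unique (hL : ∀ ν, IsLoop Δ (L ν) (hadamardConj ν.1)) (hc : S ∈ phase Δ L c) (hd : S ∈ phase Δ L d) : c = d := by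
  rcases c with _ | ν | _ <;> rcases d with _ | ν' | _
  · rfl
  · exact (Pre.not_mid (hL _) hc hd).elim
  · exact (Pre.not_post hc hd).elim
  · exact (Pre.not_mid (hL _) hd hc).elim
  · rw [Subtype.ext (hadamardConj_injective (Mid.state_unique (hL _) (hL _) hc hd))]
  · exact (Mid.not_post (hL _) hc hd).elim
  · exact (Pre.not_post hd hc).elim
  · exact (Mid.not_post (hL _) hd hc).elim
  · rfl

/-- The phases which can follow a phase immediately, or are equal to it. -/
def Phase.Follows : Phase → Phase → Prop
  | .pre, .post => False
  | .mid _, .pre => False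
  | .mid ν, .mid ν' => ν = ν'
  | .post, .pre => False
  | .post, .mid _ => False
  | _, _ => True

theorem exists_phase_of_next (hL : ∀ ν, IsLoop Δ (L ν) (hadamardConj ν.1)) (hc : S ∈ phase Δ L c) (h : Next Δ S T) :
    ∃ d, T ∈ phase Δ L d ∧ c.Follows d := by
  rcases c with _ | ν | _
  · rcases h with ⟨α, h⟩ | ⟨p, h⟩
    · rcases Pre.trans hc h with ⟨_, h⟩ | ⟨x, ν, _, h, _⟩
      · exact ⟨.pre, h, trivial⟩
      · exact ⟨.mid ν, h, trivial⟩
    · exact (Pre.ptrans hc h).elim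
  · rcases h with ⟨α, h⟩ | ⟨p, h⟩
    · rcases Mid.trans (hL ν) hc h with ⟨_, h⟩ | ⟨x, _, _, h⟩
      · exact ⟨.mid ν, h, rfl⟩
      · exact ⟨.post, h, trivial⟩
    · exact ⟨.mid ν, Mid.ptrans (hL ν) hc h, rfl⟩
  · rcases h with ⟨α, h⟩ | ⟨p, h⟩
    · exact ⟨.post, (Post.trans hc h).2, trivial⟩
    · exact (Post.ptrans hc h).elim

theorem samePhase_iff (hL : ∀ ν, IsLoop Δ (L ν) (hadamardConj ν.1)) (hc : S ∈ phase Δ L c) : SamePhase Δ L S T ↔ T ∈ phase Δ L c := by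
  constructor
  · rintro (rfl | ⟨d, h1, h2⟩)
    · exact hc
    · rwa [phase_unique hL hc h1]
  · exact fun h => .inr ⟨c, hc, h⟩

theorem setOf_samePhase (hL : ∀ ν, IsLoop Δ (L ν) (hadamardConj ν.1)) (hc : S ∈ phase Δ L c) : {T | SamePhase Δ L S T} = phase Δ L c := by
  ext T; exact samePhase_iff hL hc

theorem samePhase_of_mem (hS : S ∈ phase Δ L c) (hT : T ∈ phase Δ L c) : SamePhase Δ L S T :=
  .inr ⟨c, hS, hT⟩

theorem mu_mid_post (hL : ∀ ν, IsLoop Δ (L ν) (hadamardConj ν.1)) {ν : Density} (hS : S ∈ phase Δ L (.mid ν)) :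
    mu Δ (SamePhase Δ L) S (phase Δ L .post) = 1 :=
  Mid.mu_eq_one (hL ν) (fun _ hS _ hT => samePhase_of_mem (c := .mid ν) hS hT) hS

theorem mu_pre_mid (hL : ∀ ν, IsLoop Δ (L ν) (hadamardConj ν.1)) {ν : Density} (hS : S ∈ phase Δ L .pre) :
    mu Δ (SamePhase Δ L) S (phase Δ L (.mid ν)) = 1 := by
  suffices h : Reaches Δ (SamePhase Δ L) S (phase Δ L (.mid ν)) ∧
      mu Δ (SamePhase Δ L) S (phase Δ L (.mid ν)) = 1 from h.2
  have hS' : Pre Δ L S := hS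
  induction hS' with
  | recv h =>
    have hn := fun h' => Pre.not_mid (hL ν) (Pre.recv h) h'
    obtain ⟨h0, x, F, h1, h2⟩ := h
    have hr : Reaches Δ (SamePhase Δ L) (F ν) (phase Δ L (.mid ν)) := ⟨_, (h2 ν).1, .refl⟩
    refine ⟨⟨_, (h2 ν).1, .single ⟨.inl ⟨_, (h1 _ _).2 ⟨ν, rfl, rfl⟩⟩, .inl (h2 ν).1⟩⟩, ?_⟩
    rw [mu_of_muStep_eq (T := F ν), mu_of_mem (M := phase Δ L (.mid ν)) (h2 ν).1]
    refine muStep_of_unique hn h0 ?_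
    ext V
    simp only [actSucc, h1, Set.mem_ofPred_eq, Set.mem_singleton_iff]
    constructor
    · rintro ⟨⟨_, ν', _, rfl⟩, h3, _⟩
      have h4 : F ν' ∈ phase Δ L (.mid ν') := (h2 ν').1
      rcases h3 with h3 | h3
      · have := phase_unique hL h3 h4
        simp only [Phase.mid.injEq] at this
        rw [this]
      · cases phase_unique hL ((samePhase_iff hL hS).1 h3) h4
    · rintro rfl; exact ⟨⟨_, ν, rfl, rfl⟩, .inl (h2 ν).1, hr⟩
  | det h h' ih =>
    obtain ⟨h1, h2⟩ := ih h'
    have h3 := samePhase_of_mem (c := .pre) hS h'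
    constructor
    · obtain ⟨U, hU, h4⟩ := h1
      refine ⟨U, hU, .head ⟨h.silent.next, .inr h3⟩ (Relation.ReflTransGen.mono ?_ _ _ h4)⟩
      rintro V W ⟨h5, h6⟩
      exact ⟨h5, h6.imp id fun h6 => samePhase_of_mem hS ((samePhase_iff hL (c := .pre) h').1 h6)⟩
    · refine (mu_of_muStep_eq ?_).trans h2
      exact muStep_of_unique (fun h' => Pre.not_mid (hL ν) hS h') h.2
        (actSucc_of_det h (.inr h3) h1)

/-- The probability to reach a class from a state depends only on the phase of the state. -/
theorem mu_congr (hL : ∀ ν, IsLoop Δ (L ν) (hadamardConj ν.1)) (hS : S ∈ phase Δ L c) (hT : T ∈ phase Δ L c) (U : State) :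
    mu Δ (SamePhase Δ L) S {V | SamePhase Δ L U V} =
      mu Δ (SamePhase Δ L) T {V | SamePhase Δ L U V} := by
  have hK : ∀ S ∈ phase Δ L c, ∀ T, SamePhase Δ L S T → T ∈ phase Δ L c :=
    fun S hS T => (samePhase_iff hL hS).1
  by_cases hU : ∃ d, U ∈ phase Δ L d
  · obtain ⟨d, hU⟩ := hU
    rw [setOf_samePhase hL hU]
    by_cases hcd : c = d
    · subst hcd
      rw [mu_of_mem hS, mu_of_mem hT]
    by_cases hf : c.Follows d
    · rcases c with _ | ν | _ <;> rcases d with _ | ν' | _ <;> simp only [Phase.Follows] at hf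
      · exact (hcd rfl).elim
      · rw [mu_pre_mid hL hS, mu_pre_mid hL hT]
      · exact (hcd (congrArg _ hf)).elim
      · rw [mu_mid_post hL hS, mu_mid_post hL hT]
      · exact (hcd rfl).elim
    · have h1 : ∀ S ∈ phase Δ L c, S ∉ phase Δ L d := fun S h h' => hcd (phase_unique hL h h')
      have h2 : ∀ S ∈ phase Δ L c, ∀ T, Next Δ S T → T ∉ phase Δ L d := by
        intro S h T h3 h4
        obtain ⟨d', h5, h6⟩ := exists_phase_of_next hL h h3
        rw [phase_unique hL h5 h4] at h6
        exact hf h6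
      rw [mu_eq_zero hK h1 h2 hS, mu_eq_zero hK h1 h2 hT]
  · have h0 : ∀ V, V ∈ {V | SamePhase Δ L U V} → V = U := by
      rintro V (rfl | ⟨d, h, _⟩)
      · rfl
      · exact (hU ⟨d, h⟩).elim
    have h1 : ∀ S ∈ phase Δ L c, S ∉ {V | SamePhase Δ L U V} := by
      intro S h h'
      rw [h0 S h'] at h
      exact hU ⟨c, h⟩
    have h2 : ∀ S ∈ phase Δ L c, ∀ T, Next Δ S T → T ∉ {V | SamePhase Δ L U V} := by
      intro S h T h3 h'
      obtain ⟨d, h4, _⟩ := exists_phase_of_next hL h h3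
      rw [h0 T h'] at h4
      exact hU ⟨d, h4⟩
    rw [mu_eq_zero hK h1 h2 hS, mu_eq_zero hK h1 h2 hT]

theorem samePhase_isBisimulation (hL : ∀ ν, IsLoop Δ (L ν) (hadamardConj ν.1)) : IsBisimulation Δ (SamePhase Δ L) where
  equivalence := by
    refine ⟨fun S => .inl rfl, ?_, ?_⟩
    · rintro S T (rfl | ⟨c, h1, h2⟩)
      exacts [.inl rfl, .inr ⟨c, h2, h1⟩]
    · rintro S T U (rfl | ⟨c, h1, h2⟩) h
      · exact h
      · exact .inr ⟨c, h1, (samePhase_iff hL h2).1 h⟩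
  sameLabel := by
    rintro S T S' α hα (rfl | ⟨c, h1, h2⟩) ht
    · exact ⟨S, S', .refl, ht, .inl rfl, .inl rfl⟩
    · exfalso
      rcases c with _ | ν | _
      · rcases Pre.trans h1 ht with ⟨rfl, _⟩ | ⟨_, _, rfl, _⟩ <;> simp at hα
      · rcases Mid.trans (hL ν) h1 ht with ⟨rfl, _⟩ | ⟨_, rfl, _⟩ <;> simp at hα
      · obtain ⟨rfl, _⟩ := Post.trans h1 ht; simp at hα
  sendQubit := by
    rintro S T S' g x (rfl | ⟨c, h1, h2⟩) ht
    · exact ⟨S, S', x, .refl, ht, rfl, .inl rfl, .inl rfl⟩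
    · rcases c with _ | ν | _
      · rcases Pre.trans h1 ht with ⟨h, _⟩ | ⟨_, _, h, _⟩ <;> cases h
      · rcases Mid.trans (hL ν) h1 ht with ⟨h, _⟩ | ⟨_, h, h3, h4⟩
        · cases h
        cases h
        obtain ⟨T', h5, h6⟩ := Mid.exists_sends (hL ν) h2
        obtain ⟨_, y, T'', h7, h8, h9⟩ := id h6
        exact ⟨T', T'', y, h5, (h7 _ _).2 ⟨rfl, rfl⟩, by rw [h3, h8],
          samePhase_of_mem (c := .mid ν) h1 ⟨_, .sends h6⟩, samePhase_of_mem (c := .post) h4 h9⟩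
      · cases (Post.trans h1 ht).1
  recvQubit := by
    rintro S T S' g x (rfl | ⟨c, h1, h2⟩) ht
    · exact ⟨S, S', x, .refl, ht, rfl, .inl rfl, .inl rfl⟩
    · rcases c with _ | ν | _
      · rcases Pre.trans h1 ht with ⟨h, _⟩ | ⟨_, ν, h, h3, h4⟩
        · cases h
        cases h
        obtain ⟨T', h5, h6⟩ := Pre.exists_receives h2
        obtain ⟨_, y, F, h7, h8⟩ := id h6
        exact ⟨T', F ν, y, h5, (h7 _ _).2 ⟨ν, rfl, rfl⟩, by rw [h4, (h8 ν).2],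
          samePhase_of_mem (c := .pre) h1 (.recv h6), samePhase_of_mem (c := .mid ν) h3 (h8 ν).1⟩
      · rcases Mid.trans (hL ν) h1 ht with ⟨h, _⟩ | ⟨_, h, _⟩ <;> cases h
      · cases (Post.trans h1 ht).1
  silent := by
    rintro S T S' (rfl | ⟨c, h1, h2⟩) ht
    · exact ⟨S, S', .refl, .inr ht, .inl rfl, .inl rfl⟩
    · refine ⟨T, T, .refl, .inl rfl, samePhase_of_mem h1 h2, ?_⟩
      rcases c with _ | ν | _
      · exact samePhase_of_mem (c := .pre) (Pre.silent h1 ht) h2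
      · exact samePhase_of_mem (c := .mid ν) (Mid.silent (hL ν) h1 ht) h2
      · rcases ht with ht | ⟨p, ht⟩
        · exact samePhase_of_mem (c := .post) (Post.trans h1 ht).2 h2
        · exact (Post.ptrans h1 ht).elim
  probabilities := by
    rintro S T (rfl | ⟨c, h1, h2⟩) U
    · rfl
    · exact mu_congr hL h1 h2 U

/-- From every state between the input and the output, the class of the output is reached with
probability `1`. -/
theorem mu_eq_one_of_pre (hL : ∀ ν, IsLoop Δ (L ν) (hadamardConj ν.1)) {S₀ S₁ S₂ S₃ S₄ : State} {x y : Var} {g g' : Gate} (h₀ : Pre Δ L S₀)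
    (h₁ : Relation.ReflTransGen (Silent Δ) S₀ S₁) (h₂ : Trans Δ S₁ (.recvQubit g x) S₂)
    (h : Relation.ReflTransGen (Silent Δ) S₂ S) (h₃ : Relation.ReflTransGen (Silent Δ) S S₃)
    (h₄ : Trans Δ S₃ (.sendQubit g' y) S₄) :
    mu Δ (SamePhase Δ L) S {V | SamePhase Δ L S₄ V} = 1 := by
  rcases (h₀.silents h₁).trans h₂ with ⟨h', _⟩ | ⟨_, ν, h', h5, _⟩
  · cases h'
  have h6 := Mid.silents (hL ν) h5 h
  rcases Mid.trans (hL ν) (Mid.silents (hL ν) h6 h₃) h₄ with ⟨h', _⟩ | ⟨_, _, _, h7⟩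
  · cases h'
  rw [setOf_samePhase hL (c := .post) h7]
  exact mu_mid_post hL (ν := ν) h6

end Bisimulation

/-! ### Transitions of processes -/

section Steps

variable {Δ : Defs} {Γ : Frame} {P P' Q Q' : Proc} {C C' : Ctx} {D : PCtx}

theorem Stable.not_resolve (h : Stable Δ P) (d : List (ℝ × Proc)) : ¬ Resolve Δ P d := by
  induction h generalizing d with
  | nil | fin | act | decl => intro hr; cases hr
  | scope _ ih | guard _ ih | restrict _ ih | seq _ ih | call _ ih =>
    intro hr; cases hr with | _ h => exact ih _ h
  | par _ _ ih1 ih2 =>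
    intro hr
    cases hr with
    | parL h _ | parLR h _ => exact ih1 _ h
    | parR _ h => exact ih2 _ h
  | sum _ _ ih1 ih2 =>
    intro hr
    cases hr with
    | sumL h _ | sumLR h _ => exact ih1 _ h
    | sumR _ h => exact ih2 _ h

theorem Stable.not_ptrans (h : Stable Δ P) (p : ℝ) (V : State) : ¬ PTrans Δ ⟨P, .pure C⟩ p V := by
  intro ht
  cases ht with
  | proc _ _ h' _ => exact h.not_resolve _ h'

/-- The only transition of `P / C` is internal, and leads to `P' / D`. -/
def OnlyTau (Δ : Defs) (Γ : Frame) (P : Proc) (C : Ctx) (P' : Proc) (D : PCtx) : Prop :=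
  ∀ α Q D', Step Δ Γ P C α Q D' ↔ α = .tau ∧ Q = P' ∧ D' = D

/-- The only transition of `P / C` is a successful termination, with the context `C'`. -/
def OnlyTerm (Δ : Defs) (Γ : Frame) (P : Proc) (C : Ctx) (P' : Proc) (C' : Ctx) : Prop :=
  ∀ α Q D', Step Δ Γ P C α Q D' ↔ α = .term ∧ Q = P' ∧ D' = .pure C'

/-- The only transition of `P / C` is the emission of the value `v` at the gate `g`. -/
def OnlySend (Δ : Defs) (Γ : Frame) (P : Proc) (C : Ctx) (g : Gate) (v : ℤ) (P' : Proc) : Prop :=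
  ∀ α Q D', Step Δ Γ P C α Q D' ↔ α = .sendVal g v ∧ Q = P' ∧ D' = .pure C

/-- `E` is an evaluation context: the transitions of `E P` are those of `P`, unless `P` is `nil` or
terminates. -/
structure IsEvalCtx (Δ : Defs) (E : Proc → Proc) : Prop where
  ne_nil : ∀ {P}, P ≠ .nil → E P ≠ .nil
  stable : ∀ {P}, Stable Δ P → Stable Δ (E P)
  step_iff : ∀ {Γ P C}, P ≠ .nil → (∀ P' D, ¬ Step Δ Γ P C .term P' D) → ∀ α Q D,
    Step Δ Γ (E P) C α Q D ↔ ∃ P', Q = E P' ∧ Step Δ Γ P C α P' D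

theorem IsEvalCtx.id : IsEvalCtx Δ fun P => P where
  ne_nil h := h
  stable h := h
  step_iff _ _ α Q D := ⟨fun h => ⟨Q, rfl, h⟩, by rintro ⟨_, rfl, h⟩; exact h⟩

theorem IsEvalCtx.seq {E : Proc → Proc} (hE : IsEvalCtx Δ E) (R : Proc) :
    IsEvalCtx Δ fun P => E (.seq P R) where
  ne_nil _ := hE.ne_nil (by simp)
  stable h := hE.stable (.seq h)
  step_iff := by
    intro Γ P C h0 ht α Q D
    rw [hE.step_iff (by simp)]
    · constructor
      · rintro ⟨_, rfl, h⟩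
        cases h with
        | seq _ h _ => exact ⟨_, rfl, h⟩
        | seqTerm _ h => exact (ht _ _ h).elim
      · rintro ⟨P', rfl, h⟩
        exact ⟨_, rfl, .seq _ h (by rintro rfl; exact ht _ _ h)⟩
    · intro P' D h
      cases h with
      | seq _ h h' => exact h' rfl

theorem IsEvalCtx.scope {E : Proc → Proc} (hE : IsEvalCtx Δ E) :
    IsEvalCtx Δ fun P => E (.scope P) where
  ne_nil _ := hE.ne_nil (by simp)
  stable h := hE.stable (.scope h)
  step_iff := by
    intro Γ P C h0 ht α Q D
    rw [hE.step_iff (by simp)]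
    · constructor
      · rintro ⟨_, rfl, h⟩
        cases h with
        | scope h _ => exact ⟨_, rfl, h⟩
        | scopeTerm h _ => exact (ht _ _ h).elim
        | scopeNil _ => exact (h0 rfl).elim
      · rintro ⟨P', rfl, h⟩
        exact ⟨_, rfl, .scope h (by rintro rfl; exact ht _ _ h)⟩
    · intro P' D h
      cases h with
      | scope h h' => exact h' rfl
      | scopeTerm h _ => exact ht _ _ h

theorem not_step_nil {α : Label} : ¬ Step Δ Γ .nil C α Q D := by
  intro h; cases h

theorem OnlyTau.step (h : OnlyTau Δ Γ P C P' D) : Step Δ Γ P C .tau P' D := (h _ _ _).2 ⟨rfl, rfl, rfl⟩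

theorem OnlyTau.ne_nil (h : OnlyTau Δ Γ P C P' D) : P ≠ .nil := by
  rintro rfl; exact not_step_nil h.step

theorem OnlyTau.not_term (h : OnlyTau Δ Γ P C P' D) (Q : Proc) (D' : PCtx) :
    ¬ Step Δ Γ P C .term Q D' := by
  intro h'; cases ((h _ _ _).1 h').1

theorem OnlyTau.evalCtx (h : OnlyTau Δ Γ P C P' D) {E : Proc → Proc} (hE : IsEvalCtx Δ E) :
    OnlyTau Δ Γ (E P) C (E P') D := by
  intro α Q D'
  rw [hE.step_iff h.ne_nil h.not_term]
  constructor
  · rintro ⟨_, rfl, h'⟩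
    obtain ⟨rfl, rfl, rfl⟩ := (h _ _ _).1 h'
    exact ⟨rfl, rfl, rfl⟩
  · rintro ⟨rfl, rfl, rfl⟩
    exact ⟨_, rfl, h.step⟩

theorem OnlyTau.det (h : OnlyTau Δ [] P C P' D) (hs : Stable Δ P) :
    Det Δ ⟨P, .pure C⟩ ⟨P', D⟩ := by
  refine ⟨?_, hs.not_ptrans⟩
  rintro α ⟨Q, D'⟩
  constructor
  · rintro ⟨_, h1, h2⟩
    cases h1
    obtain ⟨rfl, h3, h4⟩ := (h _ _ _).1 h2
    exact ⟨rfl, by dsimp only at h3 h4; rw [h3, h4]⟩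
  · rintro ⟨rfl, h1⟩
    cases h1
    exact ⟨C, rfl, h.step⟩

theorem OnlyTau.det_evalCtx (h : OnlyTau Δ [] P C P' D) (hs : Stable Δ P) {E : Proc → Proc}
    (hE : IsEvalCtx Δ E) : Det Δ ⟨E P, .pure C⟩ ⟨E P', D⟩ :=
  (h.evalCtx hE).det (hE.stable hs)

theorem onlyTerm_fin : OnlyTerm Δ Γ .fin C .nil C := by
  intro α Q D
  constructor
  · intro h; cases h; exact ⟨rfl, rfl, rfl⟩
  · rintro ⟨rfl, rfl, rfl⟩; exact .fin

theorem OnlyTerm.step (h : OnlyTerm Δ Γ P C P' C') : Step Δ Γ P C .term P' (.pure C') :=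
  (h _ _ _).2 ⟨rfl, rfl, rfl⟩

theorem OnlyTerm.seq (h : OnlyTerm Δ Γ P C P' C') (Q : Proc) :
    OnlyTau Δ Γ (.seq P Q) C Q (.pure C') := by
  intro α R D
  constructor
  · intro h'
    cases h' with
    | seq _ h1 h2 => exact (h2 ((h _ _ _).1 h1).1).elim
    | seqTerm _ h1 => obtain ⟨_, _, rfl⟩ := (h _ _ _).1 h1; exact ⟨rfl, rfl, rfl⟩
  · rintro ⟨rfl, rfl, rfl⟩
    exact .seqTerm _ h.step

theorem OnlyTerm.scope (h : OnlyTerm Δ Γ P C P' C') {e : Frame} {s : Stack}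
    (hs : C'.stack = .push e s) : OnlyTerm Δ Γ (.scope P) C .nil (C'.drop e s) := by
  intro α R D
  constructor
  · intro h'
    cases h' with
    | scope h1 h2 => exact (h2 ((h _ _ _).1 h1).1).elim
    | scopeTerm h1 h2 =>
      obtain ⟨_, _, h3⟩ := (h _ _ _).1 h1
      cases h3
      rw [hs] at h2
      cases h2
      exact ⟨rfl, rfl, rfl⟩
    | scopeNil _ => exact (not_step_nil h.step).elim
  · rintro ⟨rfl, rfl, rfl⟩
    exact .scopeTerm h.step hs

theorem OnlyTerm.restrict (h : OnlyTerm Δ Γ P C P' C') (L : List Gate) :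
    OnlyTerm Δ Γ (.restrict P L) C (.restrict P' L) C' := by
  intro α R D
  constructor
  · intro h'
    cases h' with
    | restrict h1 h2 => obtain ⟨rfl, rfl, rfl⟩ := (h _ _ _).1 h1; exact ⟨rfl, rfl, rfl⟩
  · rintro ⟨rfl, rfl, rfl⟩
    exact .restrict h.step (by simp [Label.gate])

theorem step_call_iff {k : ℕ} {args : List Var} {α : Label} :
    Step Δ Γ (.call k args) C α Q D ↔ Step Δ Γ (Δ k args) C α Q D :=
  ⟨fun h => by cases h; assumption, .call⟩

theorem onlyTau_decl (vs : List (ℕ × Ty)) (P : Proc) : OnlyTau Δ Γ (.decl vs P) C (.scope P)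
    (.pure { C with stack := .push (vs.map fun v => (Var.prog v.1, v.2)) C.stack }) := by
  intro α Q D
  constructor
  · intro h; cases h; exact ⟨rfl, rfl, rfl⟩
  · rintro ⟨rfl, rfl, rfl⟩; exact .decl _ _

theorem onlyTau_scopeNil {e : Frame} {s : Stack} (hs : C.stack = .push e s) :
    OnlyTau Δ Γ (.scope .nil) C .nil (.pure (C.drop e s)) := by
  intro α Q D
  constructor
  · intro h
    cases h with
    | scope h | scopeTerm h => exact (not_step_nil h).elim
    | scopeNil h => rw [hs] at h; cases h; exact ⟨rfl, rfl, rfl⟩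
  · rintro ⟨rfl, rfl, rfl⟩; exact .scopeNil hs

/-! Conditional choice. -/

theorem stable_cond {l : List (Cond × Proc)} (h : ∀ w ∈ l, Stable Δ w.2) :
    Stable Δ (Proc.cond l) := by
  induction l with
  | nil => exact .nil
  | cons w l ih =>
    exact .sum (.guard (h _ (by simp))) (ih fun w hw => h _ (List.mem_cons_of_mem _ hw))

theorem step_cond_iff {l : List (Cond × Proc)} (hs : ∀ w ∈ l, Stable Δ w.2) {α : Label} :
    Step Δ Γ (Proc.cond l) C α Q D ↔ ∃ w ∈ l, w.1.Holds C.val ∧ Step Δ Γ w.2 C α Q D := by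
  induction l with
  | nil =>
    constructor
    · intro h; cases h
    · rintro ⟨_, h, _⟩; cases h
  | cons w l ih =>
    have h1 := hs w (by simp)
    have h2 : ∀ w ∈ l, Stable Δ w.2 := fun w hw => hs _ (List.mem_cons_of_mem _ hw)
    constructor
    · intro h
      cases h with
      | sumL _ _ h =>
        cases h with
        | guard hc h => exact ⟨w, by simp, hc, h⟩
      | sumR _ _ h =>
        obtain ⟨w', h3, h4⟩ := (ih h2).1 h
        exact ⟨w', List.mem_cons_of_mem _ h3, h4⟩
    · rintro ⟨w', h3, hc, h⟩
      rcases List.mem_cons.1 h3 with rfl | h3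
      · exact .sumL (.guard h1) (stable_cond h2) (.guard hc h)
      · exact .sumR (.guard h1) (stable_cond h2) ((ih h2).2 ⟨w', h3, hc, h⟩)

/-! Evaluation of expressions. -/

theorem evalStep_var_iff {x : Var} {e : Exp} :
    EvalStep C (.var x) e D ↔ ∃ v, C.val x = some v ∧ e = .val v ∧ D = .pure C := by
  constructor
  · intro h; cases h; exact ⟨_, by assumption, rfl, rfl⟩
  · rintro ⟨v, h, rfl, rfl⟩; exact .var h

theorem not_evalStep_val {v : ℤ} {e : Exp} : ¬ EvalStep C (.val v) e D := by
  intro h; cases h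

theorem evalStep_app_iff {k : ℕ} {A : Admissible k} {xs : Fin k → Var} {f : Frame} {s : Stack}
    (hs : C.stack = .push f s) (hx : ∀ j, xs j ∈ C.qubits) (hi : Function.Injective xs)
    (hf : C.val C.fresh = none) {e : Exp} :
    EvalStep C (.app A xs) e D ↔ e = .var C.fresh ∧ D = .prob (A.outcomes.map fun τ =>
      (C.outcomeProb A xs τ, C.afterOutcome A xs τ f s)) := by
  constructor
  · intro h
    cases h with
    | app _ _ h1 _ _ _ => rw [hs] at h1; cases h1; exact ⟨rfl, rfl⟩
  · rintro ⟨rfl, rfl⟩; exact .app A xs hs hx hi hf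

theorem onlyTau_send {g : Gate} {e e' : Exp} (he : ∀ d D', EvalStep C e d D' ↔ d = e' ∧ D' = D)
    (h1 : ∀ v, e ≠ .val v) (h2 : ∀ x ∈ C.qubits, e ≠ .var x) :
    OnlyTau Δ Γ (.act (.send g e) P) C (.act (.send g e') P) D := by
  intro α Q D'
  constructor
  · intro h
    cases h with
    | evalSend h => obtain ⟨rfl, rfl⟩ := (he _ _).1 h; exact ⟨rfl, rfl, rfl⟩
    | sendVal => exact (h1 _ rfl).elim
    | sendQubit _ _ h => exact (h2 _ h rfl).elim
  · rintro ⟨rfl, rfl, rfl⟩; exact .evalSend ((he _ _).2 ⟨rfl, rfl⟩)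

theorem onlyTau_expr {e e' : Exp} (he : ∀ d D', EvalStep C e d D' ↔ d = e' ∧ D' = D)
    (h1 : ∀ v, e ≠ .val v) : OnlyTau Δ Γ (.act (.expr e) P) C (.act (.expr e') P) D := by
  intro α Q D'
  constructor
  · intro h
    cases h with
    | evalAct h => obtain ⟨rfl, rfl⟩ := (he _ _).1 h; exact ⟨rfl, rfl, rfl⟩
    | expr => exact (h1 _ rfl).elim
  · rintro ⟨rfl, rfl, rfl⟩; exact .evalAct ((he _ _).2 ⟨rfl, rfl⟩)

theorem onlyTau_expr_val {v : ℤ} : OnlyTau Δ Γ (.act (.expr (.val v)) P) C P (.pure C) := by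
  intro α Q D'
  constructor
  · intro h
    cases h with
    | evalAct h => exact (not_evalStep_val h).elim
    | expr => exact ⟨rfl, rfl, rfl⟩
  · rintro ⟨rfl, rfl, rfl⟩; exact .expr _ _

theorem evalStep_var_of_eq_some {x : Var} {v : ℤ} (h : C.val x = some v) (e : Exp) (D : PCtx) :
    EvalStep C (.var x) e D ↔ e = .val v ∧ D = .pure C := by
  rw [evalStep_var_iff]
  constructor
  · rintro ⟨w, h1, rfl, rfl⟩; rw [h] at h1; cases h1; exact ⟨rfl, rfl⟩
  · rintro ⟨rfl, rfl⟩; exact ⟨v, h, rfl, rfl⟩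

theorem onlySend_val {g : Gate} {v : ℤ} : OnlySend Δ Γ (.act (.send g (.val v)) P) C g v P := by
  intro α Q D'
  constructor
  · intro h
    cases h with
    | evalSend h => exact (not_evalStep_val h).elim
    | sendVal => exact ⟨rfl, rfl, rfl⟩
  · rintro ⟨rfl, rfl, rfl⟩; exact .sendVal _ _ _

theorem step_send_qubit_iff {g : Gate} {x : Var} (hx : x ∈ C.qubits) (hv : C.val x = none)
    {α : Label} : Step Δ Γ (.act (.send g (.var x)) P) C α Q D ↔
      α = .sendQubit g x ∧ Q = P ∧ D = .pure C := by
  constructor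
  · intro h
    cases h with
    | evalSend h =>
      obtain ⟨v, h1, _⟩ := evalStep_var_iff.1 h
      rw [hv] at h1
      cases h1
    | sendQubit => exact ⟨rfl, rfl, rfl⟩
  · rintro ⟨rfl, rfl, rfl⟩; exact .sendQubit _ _ hx

/-- The transitions of a reception in a classical variable. -/
theorem step_recv_val_iff {g : Gate} {x : Var} (hx : (x, Ty.nat) ∈ C.stack.vars ++ Γ)
    (hx' : (x, Ty.qubit) ∉ C.stack.vars ++ Γ) {α : Label} :
    Step Δ Γ (.act (.recv g x) P) C α Q D ↔ ∃ v, α = .recvVal g v ∧ Q = P ∧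
      D = .pure { C with val := Function.update C.val x (some v) } := by
  constructor
  · intro h
    cases h with
    | recvVal => exact ⟨_, rfl, rfl, rfl⟩
    | recvQubit _ _ h => exact (hx' h).elim
  · rintro ⟨v, rfl, rfl, rfl⟩; exact .recvVal _ _ _ hx

/-- The transitions of a reception in a qubit. -/
theorem step_recv_qubit_iff {g : Gate} {x : Var} (hx : (x, Ty.nat) ∉ C.stack.vars ++ Γ)
    (hx' : (x, Ty.qubit) ∈ C.stack.vars ++ Γ) (hq : x ∉ C.qubits) {α : Label} :
    Step Δ Γ (.act (.recv g x) P) C α Q D ↔ ∃ ν : Density, α = .recvQubit g x ∧ Q = P ∧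
      D = .pure { C with qubits := x :: C.qubits, rho := C.rho.addQubit x ν.1 } := by
  constructor
  · intro h
    cases h with
    | recvVal _ _ _ h => exact (hx h).elim
    | recvQubit _ _ _ _ h => exact ⟨⟨_, h⟩, rfl, rfl, rfl⟩
  · rintro ⟨ν, rfl, rfl, rfl⟩; exact .recvQubit _ _ hx' hq ν.2

theorem Label.gate_of_step_recv {g : Gate} {x : Var} {α : Label}
    (h : Step Δ Γ (.act (.recv g x) P) C α Q D) : α.gate = some g := by
  cases h <;> rfl

/-! Parallel composition and restriction. -/

variable {s l r : Stack} {L : List Gate}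

theorem OnlyTau.restrict_par (hC : C.stack.split = (s, l, r)) (hP : Stable Δ P) (hQ : Stable Δ Q)
    (h : OnlyTau Δ (s.vars ++ Γ) P { C with stack := l } P' D)
    (hr : ∀ α Q' D', Step Δ (s.vars ++ Γ) Q { C with stack := r } α Q' D' →
      ∃ g ∈ L, α.gate = some g) :
    OnlyTau Δ Γ (.restrict (.par P Q) L) C (.restrict (.par P' Q) L)
      (D.mapStack fun l' => .fork s l' r) := by
  intro α R D'
  constructor
  · intro h1
    cases h1 with | restrict h1 hg => ?_
    cases h1 with
    | parL h2 _ _ _ h3 =>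
      rw [hC] at h2; cases h2
      obtain ⟨rfl, rfl, rfl⟩ := (h _ _ _).1 h3
      exact ⟨rfl, rfl, rfl⟩
    | parR h2 _ _ _ h3 =>
      rw [hC] at h2; cases h2
      obtain ⟨g, h4, h5⟩ := hr _ _ _ h3
      exact (hg g h4 h5).elim
    | parTerm h2 _ _ h3 | commValL h2 _ _ h3 | commValR h2 _ _ h3 | commInitL h2 _ _ _ h3
    | commInitR h2 _ _ _ h3 | commQubitL h2 _ _ _ h3 | commQubitR h2 _ _ _ h3 =>
      rw [hC] at h2; cases h2
      cases ((h _ _ _).1 h3).1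
  · rintro ⟨rfl, rfl, rfl⟩
    exact .restrict (.parL hC hP hQ (by simp) h.step) (by simp [Label.gate])

theorem OnlySend.restrict_par_val {g : Gate} {v : ℤ} {x : Var} (hC : C.stack.split = (s, l, r))
    (hP : Stable Δ P) (hg : g ∈ L)
    (h : OnlySend Δ (s.vars ++ Γ) P { C with stack := l } g v P')
    (hx : (x, Ty.nat) ∈ r.vars ++ (s.vars ++ Γ)) (hx' : (x, Ty.qubit) ∉ r.vars ++ (s.vars ++ Γ)) :
    OnlyTau Δ Γ (.restrict (.par P (.act (.recv g x) Q)) L) C (.restrict (.par P' Q) L)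
      (.pure { C with stack := .fork s l r, val := Function.update C.val x (some v) }) := by
  have hr : ∀ α R D, Step Δ (s.vars ++ Γ) (.act (.recv g x) Q) { C with stack := r } α R D ↔ _ :=
    fun α R D => step_recv_val_iff (C := { C with stack := r }) hx hx'
  intro α R D'
  constructor
  · intro h1
    cases h1 with | restrict h1 hg' => ?_
    cases h1 with
    | parL h2 _ _ _ h3 =>
      rw [hC] at h2; cases h2
      obtain ⟨rfl, rfl, rfl⟩ := (h _ _ _).1 h3
      exact (hg' g hg rfl).elim
    | parR h2 _ _ _ h3 =>
      rw [hC] at h2; cases h2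
      exact (hg' g hg (Label.gate_of_step_recv h3)).elim
    | commValL h2 _ _ h3 h4 =>
      rw [hC] at h2; cases h2
      obtain ⟨h5, rfl, _⟩ := (h _ _ _).1 h3
      cases h5
      obtain ⟨w, h6, rfl, h7⟩ := (hr _ _ _).1 h4
      cases h6
      cases h7
      exact ⟨rfl, rfl, rfl⟩
    | commInitL h2 _ _ _ h3 h4 =>
      rw [hC] at h2; cases h2
      obtain ⟨w, h6, _⟩ := (hr _ _ _).1 h4
      cases h6
    | parTerm h2 _ _ h3 | commValR h2 _ _ h3
    | commInitR h2 _ _ _ h3 | commQubitL h2 _ _ _ h3 | commQubitR h2 _ _ _ h3 =>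
      rw [hC] at h2; cases h2
      cases ((h _ _ _).1 h3).1
  · rintro ⟨rfl, rfl, rfl⟩
    exact .restrict (.commValL (C₂ := { C with stack := r, val := Function.update C.val x (some v) })
      hC hP (.act _ _) ((h _ _ _).2 ⟨rfl, rfl, rfl⟩) ((hr _ _ _).2 ⟨v, rfl, rfl, rfl⟩))
      (by simp [Label.gate])

theorem isDensity_basisState_zero : IsDensity (basisState 0) := by
  have h : basisState 0 = Matrix.diagonal ![1, 0] := by
    ext i j; fin_cases i <;> fin_cases j <;> simp [basisState]
  rw [h]
  constructor
  · refine Matrix.PosSemidef.diagonal fun i => ?_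
    fin_cases i <;> simp
  · simp [Matrix.trace, Fin.sum_univ_two]

theorem onlyTau_restrict_par_init {g : Gate} {x : Var} (hC : C.stack.split = (s, l, r))
    (hg : g ∈ L) (hx : (x, Ty.nat) ∉ l.vars ++ (s.vars ++ Γ))
    (hx' : (x, Ty.qubit) ∈ l.vars ++ (s.vars ++ Γ)) (hq : x ∉ C.qubits) :
    OnlyTau Δ Γ (.restrict (.par (.act (.recv g x) P) (.act (.send g (.val 0)) Q)) L) C
      (.restrict (.par P Q) L)
      (.pure { C with stack := .fork s l r, qubits := x :: C.qubits,
                      rho := C.rho.addQubit x (basisState 0) }) := by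
  have hl : ∀ α R D, Step Δ (s.vars ++ Γ) (.act (.recv g x) P) { C with stack := l } α R D ↔ _ :=
    fun α R D => step_recv_qubit_iff (C := { C with stack := l }) hx hx' hq
  have hr : OnlySend Δ (s.vars ++ Γ) (.act (.send g (.val 0)) Q) { C with stack := r } g 0 Q :=
    onlySend_val
  intro α R D'
  constructor
  · intro h1
    cases h1 with | restrict h1 hg' => ?_
    cases h1 with
    | parL h2 _ _ _ h3 =>
      rw [hC] at h2; cases h2
      exact (hg' g hg (Label.gate_of_step_recv h3)).elim
    | parR h2 _ _ _ h3 =>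
      rw [hC] at h2; cases h2
      obtain ⟨rfl, rfl, rfl⟩ := (hr _ _ _).1 h3
      exact (hg' g hg rfl).elim
    | commInitR h2 _ _ _ h3 h4 =>
      rw [hC] at h2; cases h2
      obtain ⟨h5, rfl, _⟩ := (hr _ _ _).1 h4
      cases h5
      obtain ⟨ν, h6, rfl, h7⟩ := (hl _ _ _).1 h3
      cases h6
      exact ⟨rfl, rfl, rfl⟩
    | parTerm h2 _ _ h3 | commValL h2 _ _ h3 | commInitL h2 _ _ _ h3 | commQubitL h2 _ _ _ h3
    | commValR h2 _ _ h3 =>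
      rw [hC] at h2; cases h2
      obtain ⟨ν, h6, _⟩ := (hl _ _ _).1 h3
      cases h6
    | commQubitR h2 _ _ _ h3 h4 =>
      rw [hC] at h2; cases h2
      cases ((hr _ _ _).1 h4).1
  · rintro ⟨rfl, rfl, rfl⟩
    exact .restrict (.commInitR hC (.act _ _) (.act _ _) (.inl rfl)
      ((hl _ _ _).2 ⟨⟨_, isDensity_basisState_zero⟩, rfl, rfl, rfl⟩)
      ((hr _ _ _).2 ⟨rfl, rfl, rfl⟩)) (by simp [Label.gate])

theorem onlyTerm_par_fin (hC : C.stack.split = (s, l, r)) :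
    OnlyTerm Δ Γ (.par .fin .fin) C .nil (C.drop (l.vars ++ r.vars) s) := by
  intro α R D'
  constructor
  · intro h1
    cases h1 with
    | parL _ _ _ h2 h3 | parR _ _ _ h2 h3 => exact (h2 ((onlyTerm_fin _ _ _).1 h3).1).elim
    | parTerm h2 _ _ h3 => rw [hC] at h2; cases h2; exact ⟨rfl, rfl, rfl⟩
    | commValL h2 _ _ h3 | commValR h2 _ _ h3 | commInitL h2 _ _ _ h3
    | commInitR h2 _ _ _ h3 | commQubitL h2 _ _ _ h3 | commQubitR h2 _ _ _ h3 =>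
      cases ((onlyTerm_fin _ _ _).1 h3).1
  · rintro ⟨rfl, rfl, rfl⟩
    exact .parTerm hC .fin .fin .fin .fin

end Steps

/-! ### Probabilistic contexts -/

theorem flip_prob {Δ : Defs} (P : Proc) {C₁ C₂ : Ctx} (h : C₁ ≠ C₂) :
    Flip Δ ⟨P, .prob [(1 / 2, C₁), (1 / 2, C₂)]⟩ ⟨P, .pure C₁⟩ ⟨P, .pure C₂⟩ := by
  refine ⟨by simpa using h, ?_, ?_⟩
  · intro p V
    constructor
    · intro ht
      cases ht with
      | ctx _ C h1 h2 =>
        by_cases e1 : C₁ = C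
        · subst e1; simp [mass, h.symm]
        · by_cases e2 : C₂ = C
          · subst e2; simp [mass, h]
          · simp [mass, e1, e2] at h2
    · rintro ⟨rfl, rfl | rfl⟩
      · have := PTrans.ctx (Δ := Δ) P (l := [(1 / 2, C₁), (1 / 2, C₂)]) C₁ (by norm_num)
          (by simp [mass, h.symm])
        simpa [mass, h.symm] using this
      · have := PTrans.ctx (Δ := Δ) P (l := [(1 / 2, C₁), (1 / 2, C₂)]) C₂ (by norm_num)
          (by simp [mass, h])
        simpa [mass, h] using this
  · rintro α V ⟨C, hC, _⟩; cases hC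

theorem sure_prob {Δ : Defs} (P : Proc) (C : Ctx) : Sure Δ ⟨P, .prob [(1, C)]⟩ ⟨P, .pure C⟩ := by
  refine ⟨?_, ?_⟩
  · intro p V
    constructor
    · intro ht
      cases ht with
      | ctx _ C' h1 h2 =>
        by_cases e1 : C = C'
        · subst e1; simp [mass]
        · simp [mass, e1] at h2
    · rintro ⟨rfl, rfl⟩
      have := PTrans.ctx (Δ := Δ) P (l := [(1, C)]) C (by norm_num) (by simp [mass])
      simpa [mass] using this
  · rintro α V ⟨C, hC, _⟩; cases hC

/-! ### Memories with one or two qubits -/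

open scoped Kronecker

/-- The memory in which the qubit `x` has the state `ω`. -/
def mem1 (x : Var) (ω : Matrix (Fin 2) (Fin 2) ℂ) : Memory := Matrix.of fun a b => ω (a x) (b x)

/-- The operators on a pair of qubits. -/
abbrev Op2 : Type := Matrix (Fin 2 × Fin 2) (Fin 2 × Fin 2) ℂ

/-- The memory in which the pair of qubits `x`, `y` has the state `F`. -/
def mem2 (x y : Var) (F : Op2) : Memory := Matrix.of fun a b => F (a x, a y) (b x, b y)

/-- An operator on a register of two qubits, as a matrix indexed by pairs of bits. -/
def Op.toPair (A : Op 2) : Op2 := Matrix.of fun p q => A ![p.1, p.2] ![q.1, q.2]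

/-- An operator on a register of one qubit, as a matrix indexed by bits. -/
def Op.toBit (A : Op 1) : Matrix (Fin 2) (Fin 2) ℂ := Matrix.of fun p q => A ![p] ![q]

theorem addQubit_emptyCtx (x : Var) (ν : Matrix (Fin 2) (Fin 2) ℂ) :
    emptyCtx.rho.addQubit x ν = mem1 x ν := by
  ext a b; simp [emptyCtx, Memory.addQubit, mem1]

theorem addQubit_mem1 (x y : Var) (ω ν : Matrix (Fin 2) (Fin 2) ℂ) :
    (mem1 x ω).addQubit y ν = mem2 x y (ω ⊗ₖ ν) := by
  ext a b; simp [Memory.addQubit, mem1, mem2, mul_comm]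

theorem mem2_swap (x y : Var) (ω ν : Matrix (Fin 2) (Fin 2) ℂ) :
    mem2 x y (ω ⊗ₖ ν) = mem2 y x (ν ⊗ₖ ω) := by
  ext a b; simp [mem2, mul_comm]

theorem smul_mem2 (c : ℂ) (x y : Var) (F : Op2) : c • mem2 x y F = mem2 x y (c • F) := by
  ext a b; simp [mem2]

theorem traceOut_mem2 {x y : Var} (h : x ≠ y) (ω ν : Matrix (Fin 2) (Fin 2) ℂ) :
    (mem2 x y (ν ⊗ₖ ω)).traceOut x = mem1 y (ν.trace • ω) := by
  ext a b
  simp [mem2, mem1, Memory.traceOut, h.symm, Matrix.trace, Fin.sum_univ_two, add_mul]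

theorem setBits_one (x : Var) (c : Fin 1 → Fin 2) (a : Var → Fin 2) :
    setBits ![x] c a = Function.update a x (c 0) := by
  simp [setBits, List.finRange]

theorem setBits_two (x y : Var) (c : Fin 2 → Fin 2) (a : Var → Fin 2) :
    setBits ![x, y] c a = Function.update (Function.update a x (c 0)) y (c 1) := by
  simp [setBits, List.finRange]

theorem applyOp_mem1 (x : Var) (A : Op 1) (ω : Matrix (Fin 2) (Fin 2) ℂ) :
    (mem1 x ω).applyOp A ![x] = mem1 x (A.toBit * ω * A.toBitᴴ) := by
  ext a b
  have e : ∀ v : Var → Fin 2, (fun j => v (![x] j)) = ![v x] := by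
    intro v; funext j; fin_cases j; rfl
  simp only [Memory.applyOp, mem1, Matrix.of_apply, setBits_one, Function.update_self, e,
    Matrix.mul_apply, Finset.sum_mul, Matrix.conjTranspose_apply, Op.toBit]
  rw [Finset.sum_comm]
  refine Fintype.sum_equiv (Equiv.funUnique (Fin 1) (Fin 2)) _ _ fun d => ?_
  refine Fintype.sum_equiv (Equiv.funUnique (Fin 1) (Fin 2)) _ _ fun c => ?_
  have e' : ∀ c : Fin 1 → Fin 2, ![c 0] = c := by intro c; funext j; fin_cases j; rfl
  simp [Equiv.funUnique, e']

theorem applyOp_mem2 {x y : Var} (h : x ≠ y) (A : Op 2) (F : Op2) :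
    (mem2 x y F).applyOp A ![x, y] = mem2 x y (A.toPair * F * A.toPairᴴ) := by
  ext a b
  have e : ∀ v : Var → Fin 2, (fun j => v (![x, y] j)) = ![v x, v y] := by
    intro v; funext j; fin_cases j <;> rfl
  simp only [Memory.applyOp, mem2, Matrix.of_apply, setBits_two, Function.update_self, e,
    Function.update_of_ne h, Matrix.mul_apply, Finset.sum_mul, Matrix.conjTranspose_apply,
    Op.toPair]
  rw [Finset.sum_comm]
  refine Fintype.sum_equiv (finTwoArrowEquiv (Fin 2)) _ _ fun d => ?_
  refine Fintype.sum_equiv (finTwoArrowEquiv (Fin 2)) _ _ fun c => ?_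
  have e' : ∀ c : Fin 2 → Fin 2, ![c 0, c 1] = c := by intro c; funext j; fin_cases j <;> rfl
  simp [finTwoArrowEquiv, e']

theorem sum_fin_one_arrow (f : (Fin 1 → Fin 2) → ℂ) : ∑ c, f c = f ![0] + f ![1] := by
  rw [← Fin.sum_univ_two fun i : Fin 2 => f ![i]]
  refine Fintype.sum_equiv (Equiv.funUnique (Fin 1) (Fin 2)) _ _ fun c => ?_
  congr 1; funext j; fin_cases j; rfl

theorem applyOp_mem2_left {x y : Var} (h : x ≠ y) (A : Op 1) (F : Op2) :
    (mem2 x y F).applyOp A ![x] =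
      mem2 x y ((A.toBit ⊗ₖ 1) * F * (A.toBit ⊗ₖ (1 : Matrix (Fin 2) (Fin 2) ℂ))ᴴ) := by
  ext a b
  have e : ∀ v : Var → Fin 2, (fun j => v (![x] j)) = ![v x] := by
    intro v; funext j; fin_cases j; rfl
  simp only [Memory.applyOp, mem2, Matrix.of_apply, setBits_one, Function.update_self, e,
    Function.update_of_ne h.symm, Matrix.mul_apply, Matrix.conjTranspose_apply,
    Op.toBit, Fintype.sum_prod_type, Matrix.kroneckerMap_apply, Matrix.one_apply,
    sum_fin_one_arrow, Fin.sum_univ_two]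
  generalize a y = u
  generalize b y = v
  fin_cases u <;> fin_cases v <;> simp <;> ring

theorem traceList_mem1 (x : Var) (ω : Matrix (Fin 2) (Fin 2) ℂ) :
    (mem1 x ω).traceList [x] (fun _ => 0) (fun _ => 0) = ω.trace := by
  simp [Memory.traceList, Memory.traceOut, mem1, Matrix.trace, Fin.sum_univ_two]

theorem traceList_mem2 {x y : Var} (h : x ≠ y) (F : Op2) {l : List Var}
    (hl : l = [x, y] ∨ l = [y, x]) :
    (mem2 x y F).traceList l (fun _ => 0) (fun _ => 0) = F.trace := by
  rcases hl with rfl | rfl <;>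
  simp [Memory.traceList, Memory.traceOut, mem2, Matrix.trace, Fintype.sum_prod_type,
    Fin.sum_univ_two, h, h.symm] <;>
  ring

/-! ### The measurements -/

/-- The eigenprojector of the observable `O` for the eigenvalue `τ`. -/
def obsProj (O : Matrix (Fin 2) (Fin 2) ℂ) (τ : ℂ) : Matrix (Fin 2) (Fin 2) ℂ :=
  (1 / 2 : ℂ) • (1 + τ • O)

/-- The eigenprojector of the observable `O ⊗ X` for the eigenvalue `τ`. -/
def pairProj (O : Matrix (Fin 2) (Fin 2) ℂ) (τ : ℂ) : Op2 :=
  (1 / 2 : ℂ) • (1 + τ • (O ⊗ₖ pauliX.1))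

theorem toBit_measure (O : Observable) (τ : ℤ) :
    ((measure ![O]).op τ).toBit = obsProj O.1 τ := by
  ext i j
  fin_cases i <;> fin_cases j <;> simp [measure, Op.toBit, obsProj, tensor, Matrix.one_apply, mul_add]

theorem toPair_measure (O : Observable) (τ : ℤ) :
    ((measure ![O, pauliX]).op τ).toPair = pairProj O.1 τ := by
  ext ⟨i, j⟩ ⟨k, l⟩
  simp only [measure, Op.toPair, pairProj, tensor, Matrix.smul_apply, Matrix.add_apply,
    Matrix.of_apply, Matrix.kroneckerMap_apply, Fin.prod_univ_two, Matrix.one_apply]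
  congr 3
  simp [Prod.ext_iff, funext_iff, Fin.forall_fin_two]

theorem toBit_hadamard : (hadamard.op 0).toBit = hadamardMatrix := by
  ext i j; simp [hadamard, unitary, Op.toBit, tensor]

/-- The state of a pair of qubits after the measurement of `O₀ ⊗ X` with the outcome `m`, which has the
probability `1/2`. -/
def transferHalf (O₀ : Matrix (Fin 2) (Fin 2) ℂ) (m : ℂ) (F : Op2) : Op2 :=
  (2 : ℂ) • (pairProj O₀ m * F * (pairProj O₀ m)ᴴ)

/-- The state of a pair of qubits after the measurements of `O₀ ⊗ X` and `O₁`, with the outcomes `m` and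
`n`, which have the probability `1/2`. -/
def transferState (O₀ O₁ : Matrix (Fin 2) (Fin 2) ℂ) (m n : ℂ) (F : Op2) : Op2 :=
  (2 : ℂ) • ((obsProj O₁ n ⊗ₖ 1) * transferHalf O₀ m F *
    (obsProj O₁ n ⊗ₖ (1 : Matrix (Fin 2) (Fin 2) ℂ))ᴴ)

/-- The effect on `ω` of the Pauli operator which multiplies `X` by `m` and `Z` by `n`, where `m` and `n`
are `1` or `-1`. -/
def pauliConj (m n : ℂ) (ω : Matrix (Fin 2) (Fin 2) ℂ) : Matrix (Fin 2) (Fin 2) ℂ :=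
  !![(1 + n) / 2 * ω 0 0 + (1 - n) / 2 * ω 1 1, m * ((1 + n) / 2 * ω 0 1 + (1 - n) / 2 * ω 1 0);
    m * ((1 + n) / 2 * ω 1 0 + (1 - n) / 2 * ω 0 1), (1 + n) / 2 * ω 1 1 + (1 - n) / 2 * ω 0 0]

theorem trace_pauliConj (m n : ℂ) (ω : Matrix (Fin 2) (Fin 2) ℂ) :
    (pauliConj m n ω).trace = ω.trace := by
  simp [pauliConj, Matrix.trace, Fin.sum_univ_two]; ring

theorem pauliConj_pauliConj {m n m' n' : ℂ} (hn : n * n = 1) (hn' : n' * n' = 1)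
    (ω : Matrix (Fin 2) (Fin 2) ℂ) :
    pauliConj m n (pauliConj m' n' ω) = pauliConj (m * m') (n * n') ω := by
  rcases mul_self_eq_one_iff.1 hn with rfl | rfl <;>
  rcases mul_self_eq_one_iff.1 hn' with rfl | rfl <;>
  · ext i j; fin_cases i <;> fin_cases j <;> simp [pauliConj] <;> ring

theorem trace_obsProj {O : Matrix (Fin 2) (Fin 2) ℂ} (hO : O.trace = 0) (τ : ℂ) :
    (obsProj O τ).trace = 1 := by
  simp [obsProj, hO]

theorem conjTranspose_obsProj {O : Matrix (Fin 2) (Fin 2) ℂ} (hO : Oᴴ = O) {τ : ℂ}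
    (hτ : conj τ = τ) : (obsProj O τ)ᴴ = obsProj O τ := by
  simp [obsProj, Matrix.conjTranspose_smul, hO, hτ]

theorem conjTranspose_pairProj {O : Matrix (Fin 2) (Fin 2) ℂ} (hO : Oᴴ = O) {τ : ℂ}
    (hτ : conj τ = τ) : (pairProj O τ)ᴴ = pairProj O τ := by
  simp [pairProj, Matrix.conjTranspose_smul, hO, hτ, Matrix.conjTranspose_kronecker, pauliX.2.1]

theorem pairProj_mul_mul {O ω ζ : Matrix (Fin 2) (Fin 2) ℂ} (τ : ℂ) :
    pairProj O τ * (ω ⊗ₖ ζ) * pairProj O τ = (1 / 4 : ℂ) • (ω ⊗ₖ ζ +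
      τ • ((O * ω) ⊗ₖ (pauliX.1 * ζ)) + τ • ((ω * O) ⊗ₖ (ζ * pauliX.1)) +
      (τ * τ) • ((O * ω * O) ⊗ₖ (pauliX.1 * ζ * pauliX.1))) := by
  simp only [pairProj, Matrix.smul_mul, Matrix.mul_smul, add_mul, mul_add, one_mul, mul_one,
    Matrix.mul_kronecker_mul]
  module

theorem transferState_eq {O₀ O₁ : Matrix (Fin 2) (Fin 2) ℂ} (h₀ : O₀ᴴ = O₀) (h₁ : O₁ᴴ = O₁) {m n : ℂ}
    (hm : conj m = m) (hn : conj n = n) (ω ζ : Matrix (Fin 2) (Fin 2) ℂ) :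
    transferState O₀ O₁ m n (ω ⊗ₖ ζ) =
      (obsProj O₁ n * ω * obsProj O₁ n) ⊗ₖ ζ +
      m • ((obsProj O₁ n * (O₀ * ω) * obsProj O₁ n) ⊗ₖ (pauliX.1 * ζ)) +
      m • ((obsProj O₁ n * (ω * O₀) * obsProj O₁ n) ⊗ₖ (ζ * pauliX.1)) +
      (m * m) • ((obsProj O₁ n * (O₀ * ω * O₀) * obsProj O₁ n) ⊗ₖ
        (pauliX.1 * ζ * pauliX.1)) := by
  rw [transferState, transferHalf, conjTranspose_pairProj h₀ hm, pairProj_mul_mul,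
    Matrix.conjTranspose_kronecker, conjTranspose_obsProj h₁ hn, Matrix.conjTranspose_one]
  simp only [Matrix.smul_mul, Matrix.mul_smul, add_mul, mul_add, ← Matrix.mul_kronecker_mul,
    one_mul, mul_one]
  module

theorem trace_pairProj {O : Matrix (Fin 2) (Fin 2) ℂ} (hO : Oᴴ = O) (hO' : O * O = 1) {m : ℂ}
    (hm : conj m = m) (hm' : m * m = 1) {ω ζ : Matrix (Fin 2) (Fin 2) ℂ} (hω : ω.trace = 1)
    (hζ : ζ.trace = 1) (hX : (pauliX.1 * ζ).trace = 0) :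
    (pairProj O m * (ω ⊗ₖ ζ) * (pairProj O m)ᴴ).trace = 1 / 2 := by
  rw [conjTranspose_pairProj hO hm, pairProj_mul_mul]
  have h1 : (ζ * pauliX.1).trace = 0 := by rw [Matrix.trace_mul_comm, hX]
  have h2 : (pauliX.1 * ζ * pauliX.1).trace = 1 := by
    rw [Matrix.trace_mul_comm, ← Matrix.mul_assoc, pauliX.2.2, one_mul, hζ]
  have h3 : (O * ω * O).trace = 1 := by
    rw [Matrix.trace_mul_comm, ← Matrix.mul_assoc, hO', one_mul, hω]
  simp only [Matrix.trace_smul, Matrix.trace_add, Matrix.trace_kronecker, hω, hζ, hX, h1, h2, h3,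
    hm', smul_eq_mul]
  norm_num

theorem hadamardConj_eq (ω : Matrix (Fin 2) (Fin 2) ℂ) : hadamardConj ω =
    !![(ω 0 0 + ω 0 1 + ω 1 0 + ω 1 1) / 2, (ω 0 0 - ω 0 1 + ω 1 0 - ω 1 1) / 2;
      (ω 0 0 + ω 0 1 - ω 1 0 - ω 1 1) / 2, (ω 0 0 - ω 0 1 - ω 1 0 + ω 1 1) / 2] := by
  have h : ((Real.sqrt 2 : ℝ) : ℂ)⁻¹ * ((Real.sqrt 2 : ℝ) : ℂ)⁻¹ = (2 : ℂ)⁻¹ := by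
    rw [← mul_inv, ← Complex.ofReal_mul, Real.mul_self_sqrt (by norm_num)]; norm_num
  have h' : star (((Real.sqrt 2 : ℝ) : ℂ)⁻¹) = ((Real.sqrt 2 : ℝ) : ℂ)⁻¹ := by simp
  rw [hadamardConj, hadamardMatrix, Matrix.conjTranspose_smul, h']
  simp only [Matrix.smul_mul, Matrix.mul_smul, smul_smul, h]
  have h2 : (!![1, 1; 1, -1] : Matrix (Fin 2) (Fin 2) ℂ)ᴴ = !![1, 1; 1, -1] := by
    ext i j; fin_cases i <;> fin_cases j <;> simp [Matrix.conjTranspose_apply]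
  rw [h2, Matrix.eta_fin_two ω]
  simp only [Matrix.mul_fin_two]
  ext i j
  fin_cases i <;> fin_cases j <;> simp <;> ring

theorem trace_hadamardConj (ω : Matrix (Fin 2) (Fin 2) ℂ) :
    (hadamardConj ω).trace = ω.trace := by
  rw [hadamardConj_eq]; simp [Matrix.trace, Fin.sum_univ_two]; ring

theorem smul_pairProj (s m : ℂ) (O : Matrix (Fin 2) (Fin 2) ℂ) :
    pairProj (s • O) m = pairProj O (s * m) := by
  simp [pairProj, Matrix.smul_kronecker, smul_smul, mul_comm]

theorem smul_obsProj (s m : ℂ) (O : Matrix (Fin 2) (Fin 2) ℂ) :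
    obsProj (s • O) m = obsProj O (s * m) := by
  simp [obsProj, smul_smul, mul_comm]

theorem pauliX_val : pauliX.1 = !![0, 1; 1, 0] := rfl

theorem pauliZ_val : pauliZ.1 = !![1, 0; 0, -1] := rfl

theorem obsProj_pauliX (τ : ℂ) : obsProj pauliX.1 τ = !![1 / 2, τ / 2; τ / 2, 1 / 2] := by
  ext i j; fin_cases i <;> fin_cases j <;> simp [obsProj, pauliX] <;> ring

theorem obsProj_pauliZ (τ : ℂ) : obsProj pauliZ.1 τ = !![(1 + τ) / 2, 0; 0, (1 - τ) / 2] := by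
  ext i j; fin_cases i <;> fin_cases j <;> simp [obsProj, pauliZ] <;> ring

/-- The transfer which simulates the Hadamard transformation. -/
theorem transferState_hadamard {m n : ℂ} (hm : m * m = 1) (hn : n * n = 1)
    (ω : Matrix (Fin 2) (Fin 2) ℂ) :
    transferState pauliZ.1 pauliX.1 m n (ω ⊗ₖ obsProj pauliZ.1 1) =
      obsProj pauliX.1 n ⊗ₖ pauliConj m n (hadamardConj ω) := by
  have hm' : conj m = m := by rcases mul_self_eq_one_iff.1 hm with rfl | rfl <;> simp
  have hn' : conj n = n := by rcases mul_self_eq_one_iff.1 hn with rfl | rfl <;> simp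
  rw [transferState_eq pauliZ.2.1 pauliX.2.1 hm' hn', hm, hadamardConj_eq,
    Matrix.eta_fin_two ω, pauliConj]
  simp only [obsProj_pauliX, obsProj_pauliZ]
  simp only [pauliX_val, pauliZ_val, Matrix.mul_fin_two]
  rcases mul_self_eq_one_iff.1 hn with rfl | rfl <;>
  · ext ⟨i, j⟩ ⟨k, l⟩
    fin_cases i <;> fin_cases j <;> fin_cases k <;> fin_cases l <;>
      simp <;> ring

/-- The transfer which simulates the identity. -/
theorem transferState_pauli {m n n₀ : ℂ} (hm : m * m = 1) (hn : n * n = 1) (hn₀ : n₀ * n₀ = 1)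
    (ω : Matrix (Fin 2) (Fin 2) ℂ) :
    transferState pauliX.1 pauliZ.1 m n (ω ⊗ₖ obsProj pauliZ.1 n₀) =
      obsProj pauliZ.1 n ⊗ₖ pauliConj m (n * n₀) ω := by
  have hm' : conj m = m := by rcases mul_self_eq_one_iff.1 hm with rfl | rfl <;> simp
  have hn' : conj n = n := by rcases mul_self_eq_one_iff.1 hn with rfl | rfl <;> simp
  rw [transferState_eq pauliX.2.1 pauliZ.2.1 hm' hn', hm, Matrix.eta_fin_two ω,
    pauliConj]
  simp only [obsProj_pauliZ]
  simp only [pauliX_val, Matrix.mul_fin_two]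
  rcases mul_self_eq_one_iff.1 hn with rfl | rfl <;>
  rcases mul_self_eq_one_iff.1 hn₀ with rfl | rfl <;>
  · ext ⟨i, j⟩ ⟨k, l⟩
    fin_cases i <;> fin_cases j <;> fin_cases k <;> fin_cases l <;>
      simp

/-! ### Trees of the steps of the simulation -/

theorem Ctx.fresh_eq_zero {C : Ctx} (h : C.val (.res 0) = none) : C.fresh = .res 0 := by
  rw [Ctx.fresh, Nat.sInf_eq_zero.2 (.inl h)]

theorem Ctx.fresh_eq_one {C : Ctx} {v : ℤ} (h : C.val (.res 0) = some v)
    (h' : C.val (.res 1) = none) : C.fresh = .res 1 := by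
  have h1 : sInf {k | C.val (.res k) = none} ≤ 1 := Nat.sInf_le h'
  have h2 : C.val (.res (sInf {k | C.val (.res k) = none})) = none :=
    Nat.sInf_mem (s := {k | C.val (.res k) = none}) ⟨1, h'⟩
  have h3 : sInf {k | C.val (.res k) = none} ≠ 0 := by
    intro h0
    rw [h0, h] at h2
    cases h2
  rw [Ctx.fresh, show sInf {k | C.val (.res k) = none} = 1 by omega]

theorem Ctx.drop_nil (C : Ctx) (s : Stack) : C.drop [] s = { C with stack := s } := by
  simp [Ctx.drop, Memory.traceList]

/-- The values of the outcomes of the measurements. -/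
def IsSign (a : ℤ) : Prop := a = 1 ∨ a = -1

theorem IsSign.mul_self {a : ℤ} (h : IsSign a) : (a : ℂ) * a = 1 := by
  rcases h with rfl | rfl <;> norm_num

section

variable {Δ : Defs} {L : Set State} {ω : Matrix (Fin 2) (Fin 2) ℂ} {E : Proc → Proc}

/-- The measurement of an observable, whose result is sent to a variable of the process in parallel. -/
theorem tree_measure (hE : IsEvalCtx Δ E) {k : ℕ} {O : Fin k → Observable} {xs : Fin k → Var}
    {g : Gate} {m : Var} {P Q : Proc} {G : List Gate} {C : Ctx} {e : Frame} {s l r : Stack}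
    (hg : g ∈ G) (hC : C.stack.split = (s, .push e l, r)) (hx : ∀ j, xs j ∈ C.qubits)
    (hi : Function.Injective xs) (hf : C.val C.fresh = none) (hf' : C.fresh ∉ C.qubits)
    (hm : (m, Ty.nat) ∈ r.vars ++ s.vars) (hm' : (m, Ty.qubit) ∉ r.vars ++ s.vars)
    (hprob : ∀ a, IsSign a → C.outcomeProb (measure O) xs a = 1 / 2) {p : ℤ → ℝ}
    (h : ∀ a, IsSign a → Tree Δ L ω (p a) ⟨E (.restrict (.par P Q) G), .pure
      { stack := .fork s (.push ((C.fresh, .nat) :: e) l) r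
        qubits := C.qubits
        rho := (2 : ℂ) • C.rho.applyOp ((measure O).op a) xs
        val := Function.update (Function.update C.val C.fresh (some a)) m (some a) }⟩) :
    Tree Δ L ω ((p 1 + p (-1)) / 2)
      ⟨E (.restrict (.par (.act (.send g (.app (measure O) xs)) P) (.act (.recv g m) Q)) G),
        .pure C⟩ := by
  set D : ℤ → Ctx := fun a => { C.afterOutcome (measure O) xs a e l with
    stack := .fork s (.push ((C.fresh, .nat) :: e) l) r } with hD
  have h1 : OnlyTau Δ [] _ C _ _ := OnlyTau.restrict_par (L := G)
    (P := .act (.send g (.app (measure O) xs)) P) (Q := .act (.recv g m) Q) hC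
    (.act _ _) (.act _ _)
    (onlyTau_send (C := { C with stack := .push e l })
      (fun _ _ => evalStep_app_iff (C := { C with stack := .push e l }) rfl hx hi hf)
      (by simp) (by simp))
    (fun _ _ _ h => ⟨g, hg, Label.gate_of_step_recv h⟩)
  refine .det (h1.det_evalCtx (.restrict (.par (.act _ _) (.act _ _))) hE) ?_
  have h2 : (PCtx.mapStack (fun l' => .fork s l' r) (.prob ((measure O).outcomes.map fun τ =>
      (Ctx.outcomeProb (measure O) xs τ { C with stack := .push e l },
        Ctx.afterOutcome (measure O) xs τ e l { C with stack := .push e l })))) =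
      .prob [(1 / 2, D 1), (1 / 2, D (-1))] := by
    rw [← hprob 1 (.inl rfl)]
    nth_rewrite 2 [hprob 1 (.inl rfl)]
    rw [← hprob (-1) (.inr rfl)]
    rfl
  rw [h2]
  have h3 : ∀ a, IsSign a → Tree Δ L ω (p a)
      ⟨E (.restrict (.par (.act (.send g (.var C.fresh)) P) (.act (.recv g m) Q)) G),
        .pure (D a)⟩ := by
    intro a ha
    have hv : (D a).val C.fresh = some a := by simp [hD, Ctx.afterOutcome]
    have h4 : OnlyTau Δ [] _ (D a) _ _ := OnlyTau.restrict_par (C := D a) (L := G)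
      (P := .act (.send g (.var C.fresh)) P) (Q := .act (.recv g m) Q) (s := s)
      (l := .push ((C.fresh, .nat) :: e) l) (r := r) rfl (.act _ _) (.act _ _)
      (onlyTau_send (evalStep_var_of_eq_some
        (C := { D a with stack := .push ((C.fresh, .nat) :: e) l }) hv) (by simp)
        (by rintro x hx h; cases h; exact hf' hx))
      (fun _ _ _ h => ⟨g, hg, Label.gate_of_step_recv h⟩)
    refine .det (h4.det_evalCtx (.restrict (.par (.act _ _) (.act _ _))) hE) ?_
    have h5 : OnlyTau Δ [] _ (D a) _ _ := OnlySend.restrict_par_val (C := D a) (L := G)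
      (P := .act (.send g (.val a)) P) (Q := Q) (s := s) (g := g) (x := m)
      (l := .push ((C.fresh, .nat) :: e) l) (r := r) rfl (.act _ _) hg onlySend_val
      (by simpa using hm) (by simpa using hm')
    refine .det (h5.det_evalCtx (.restrict (.par (.act _ _) (.act _ _))) hE) ?_
    have h6 := h a ha
    have h7 : ((C.outcomeProb (measure O) xs a : ℂ))⁻¹ = 2 := by rw [hprob a ha]; norm_num
    rw [← h7] at h6
    exact h6
  refine .flip (flip_prob _ ?_) (h3 1 (.inl rfl)) (h3 (-1) (.inr rfl))
  intro h
  have := congrFun (congrArg Ctx.val h) C.fresh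
  simp [hD, Ctx.afterOutcome] at this

/-- The initialization of a qubit. -/
theorem tree_init (hE : IsEvalCtx Δ E) {y : Var} {R : Proc} {C : Ctx} {e : Frame} {s : Stack}
    (hC : C.stack = .push e s) (hy : (y, Ty.nat) ∉ C.stack.vars)
    (hy' : (y, Ty.qubit) ∈ C.stack.vars) (hq : y ∉ C.qubits) {p : ℝ}
    (h : Tree Δ L ω p ⟨E R, .pure
      { C with qubits := y :: C.qubits, rho := C.rho.addQubit y (basisState 0) }⟩) :
    Tree Δ L ω p ⟨E (.seq (initQubit y) R), .pure C⟩ := by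
  have hs : C.stack.split = (C.stack, .push [] .empty, .push [] .empty) := by rw [hC]; rfl
  have h1 : OnlyTau Δ [] (initQubit y) C _ _ := onlyTau_restrict_par_init hs (by simp)
    (by simpa [Stack.vars] using hy) (by simpa [Stack.vars] using hy') hq
  refine .det (h1.det_evalCtx (.restrict (.par (.act _ _) (.act _ _))) (hE.seq R)) ?_
  have h2 := (((onlyTerm_par_fin (Δ := Δ) (Γ := []) (C := { C with
    stack := .fork C.stack (.push [] .empty) (.push [] .empty), qubits := y :: C.qubits,
    rho := C.rho.addQubit y (basisState 0) }) rfl).restrict [gateP]).seq R).det_evalCtx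
    (.seq (.restrict (.par .fin .fin))) hE
  refine .det h2 ?_
  have h3 := Ctx.drop_nil { C with
    stack := .fork C.stack (.push [] .empty) (.push [] .empty), qubits := y :: C.qubits,
    rho := C.rho.addQubit y (basisState 0) } C.stack
  simp only [Stack.vars, List.append_nil, h3]
  exact h

/-- State transfer. -/
theorem tree_transfer (hE : IsEvalCtx Δ E) {O₀ O₁ : Observable} {x y m n : ℕ} {R : Proc} {C : Ctx}
    {e : Frame} {s : Stack} {F : Op2} (hC : C.stack = .push e s) (hxy : x ≠ y)
    (hq : C.qubits = [.prog x, .prog y] ∨ C.qubits = [.prog y, .prog x])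
    (hv : ∀ k, C.val (.res k) = none)
    (hm : (.prog m, Ty.nat) ∈ C.stack.vars) (hm' : (.prog m, Ty.qubit) ∉ C.stack.vars)
    (hn : (.prog n, Ty.nat) ∈ C.stack.vars) (hn' : (.prog n, Ty.qubit) ∉ C.stack.vars)
    (hF : C.rho = mem2 (.prog x) (.prog y) F)
    (hp₁ : ∀ a, IsSign a → (pairProj O₀.1 a * F * (pairProj O₀.1 a)ᴴ).trace = 1 / 2)
    (hp₂ : ∀ a b, IsSign a → IsSign b → (transferState O₀.1 O₁.1 a b F).trace = 1) {p : ℤ → ℤ → ℝ}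
    (h : ∀ a b, IsSign a → IsSign b → Tree Δ L ω (p a b) ⟨E R, .pure
      { C with
        rho := mem2 (.prog x) (.prog y) (transferState O₀.1 O₁.1 a b F)
        val := Function.update (Function.update C.val (.prog m) (some a)) (.prog n) (some b) }⟩) :
    Tree Δ L ω (((p 1 1 + p 1 (-1)) / 2 + (p (-1) 1 + p (-1) (-1)) / 2) / 2)
      ⟨E (.seq (transfer O₀ O₁ (.prog x) (.prog y) (.prog m) (.prog n)) R), .pure C⟩ := by
  have hxy' : Var.prog x ≠ Var.prog y := by simpa using hxy
  have hq' : ∀ k, Var.res k ∉ C.qubits := by intro k; rcases hq with hq | hq <;> simp [hq]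
  have hqx : Var.prog x ∈ C.qubits := by rcases hq with hq | hq <;> simp [hq]
  have hqy : Var.prog y ∈ C.qubits := by rcases hq with hq | hq <;> simp [hq]
  have hf : C.fresh = .res 0 := Ctx.fresh_eq_zero (hv 0)
  refine tree_measure (p := fun a => (p a 1 + p a (-1)) / 2) (hE.seq R) (by simp)
    (s := C.stack) (e := []) (l := .empty) (r := .push [] .empty) (by rw [hC]; rfl) ?_ ?_
    (by rw [hf]; exact hv 0) (by rw [hf]; exact hq' 0) (by simpa [Stack.vars] using hm)
    (by simpa [Stack.vars] using hm') ?_ ?_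
  · intro j; fin_cases j <;> simpa
  · intro i j hij; fin_cases i <;> fin_cases j <;> simp_all
  · intro a ha
    rw [Ctx.outcomeProb, Ctx.trace, Ctx.apply, hF, applyOp_mem2 hxy', toPair_measure,
      traceList_mem2 hxy' _ hq, hp₁ a ha]
    norm_num
  intro a ha
  rw [hF, applyOp_mem2 hxy', toPair_measure, smul_mem2, hf]
  set C' : Ctx := {
    stack := .fork C.stack (.push [(.res 0, .nat)] .empty) (.push [] .empty)
    qubits := C.qubits
    rho := mem2 (.prog x) (.prog y) ((2 : ℂ) • (pairProj O₀.1 a * F * (pairProj O₀.1 a)ᴴ))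
    val := Function.update (Function.update C.val (.res 0) (some a)) (.prog m) (some a) } with hC'
  have hf' : C'.fresh = .res 1 :=
    Ctx.fresh_eq_one (v := a) (by simp [hC']) (by simpa [hC'] using hv 1)
  refine tree_measure (p := p a) (hE.seq R) (by simp) (C := C')
    (s := C.stack) (e := [(.res 0, .nat)]) (l := .empty) (r := .push [] .empty) rfl ?_ ?_
    (by rw [hf']; simpa [hC'] using hv 1) (by rw [hf']; exact hq' 1)
    (by simpa [Stack.vars] using hn) (by simpa [Stack.vars] using hn') ?_ ?_
  · intro j; fin_cases j; simpa
  · intro i j _; exact Subsingleton.elim i j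
  · intro b hb
    have h1 := hp₂ a b ha hb
    rw [transferState, Matrix.trace_smul, transferHalf, smul_eq_mul] at h1
    rw [Ctx.outcomeProb, Ctx.trace, Ctx.apply, applyOp_mem2_left hxy', toBit_measure,
      traceList_mem2 hxy' _ hq, eq_div_of_mul_eq two_ne_zero ((mul_comm _ _).trans h1)]
    norm_num
  intro b hb
  rw [hf', show C'.rho = _ from rfl, applyOp_mem2_left hxy', toBit_measure, smul_mem2]
  have h2 := (((onlyTerm_par_fin (Δ := Δ) (Γ := []) (C := {
    stack := .fork C.stack (.push [(.res 1, .nat), (.res 0, .nat)] .empty) (.push [] .empty)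
    qubits := C.qubits
    rho := mem2 (.prog x) (.prog y) (transferState O₀.1 O₁.1 a b F)
    val := Function.update (Function.update C'.val (.res 1) (some b)) (.prog n) (some b) })
    rfl).restrict [gateQ₁, gateQ₂]).seq R).det_evalCtx (.seq (.restrict (.par .fin .fin))) hE
  refine .det h2 ?_
  convert h a b ha hb using 3
  simp only [Ctx.drop, Stack.vars, List.append_nil, Ctx.mk.injEq, true_and]
  refine ⟨?_, ?_, ?_⟩
  · rw [List.filter_eq_self]
    intro z hz
    have : z ≠ .res 0 ∧ z ≠ .res 1 := ⟨fun h => hq' 0 (h ▸ hz), fun h => hq' 1 (h ▸ hz)⟩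
    simp [this]
  · rw [List.filter_eq_nil_iff.2]
    · rfl
    · intro z hz
      have : z ≠ .res 0 ∧ z ≠ .res 1 := ⟨fun h => hq' 0 (h ▸ hz), fun h => hq' 1 (h ▸ hz)⟩
      simp [this]
  · funext z
    rcases z with z | z
    · simp [hC', Function.update_apply]
    · by_cases h0 : z = 0
      · subst h0; simp [hv]
      by_cases h1 : z = 1
      · subst h1; simp [hv]
      · simp [hC', h0, h1]

/-- The index of the Pauli operator which multiplies `X` by `a` and `Z` by `b`. -/
def pauliIndex (a b : ℤ) : ℤ :=
  if a = 1 then if b = 1 then 0 else 1 else if b = 1 then 3 else 2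

/-- The assignment of the index of a Pauli operator, at the end of a scope. -/
theorem tree_setIndex (hE : IsEvalCtx Δ E) {c₀ c₁ c₂ c₃ : Cond} {i : Var} {R : Proc} {C : Ctx}
    {e : Frame} {s : Stack} {a b : ℤ} (hC : C.stack = .push e s)
    (hi : (i, Ty.nat) ∈ C.stack.vars) (hi' : (i, Ty.qubit) ∉ C.stack.vars)
    (ha : IsSign a) (hb : IsSign b)
    (h₀ : c₀.Holds C.val ↔ a = 1 ∧ b = 1) (h₁ : c₁.Holds C.val ↔ a = 1 ∧ b = -1)
    (h₂ : c₂.Holds C.val ↔ a = -1 ∧ b = 1) (h₃ : c₃.Holds C.val ↔ a = -1 ∧ b = -1) {p : ℝ}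
    (h : Tree Δ L ω p ⟨E R, .pure (Ctx.drop e s
      { C with val := Function.update C.val i (some (pauliIndex a b)) })⟩) :
    Tree Δ L ω p ⟨E (.seq (.scope (setIndex c₀ c₁ c₂ c₃ i)) R), .pure C⟩ := by
  have hs : C.stack.split = (C.stack, .push [] .empty, .push [] .empty) := by rw [hC]; rfl
  have hst : ∀ w ∈ [(c₀, Proc.act (.send gateR (.val 0)) .fin),
      (c₁, .act (.send gateR (.val 1)) .fin), (c₂, .act (.send gateR (.val 3)) .fin),
      (c₃, .act (.send gateR (.val 2)) .fin)], Stable Δ w.2 := by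
    simp only [List.mem_cons, List.not_mem_nil, or_false]
    rintro w (rfl | rfl | rfl | rfl) <;> exact .act _ _
  have h1 : OnlySend Δ (C.stack.vars ++ []) (.cond [(c₀, .act (.send gateR (.val 0)) .fin),
      (c₁, .act (.send gateR (.val 1)) .fin), (c₂, .act (.send gateR (.val 3)) .fin),
      (c₃, .act (.send gateR (.val 2)) .fin)]) { C with stack := .push [] .empty } gateR
      (pauliIndex a b) .fin := by
    intro α Q D
    rw [step_cond_iff hst]
    simp only [List.mem_cons, List.not_mem_nil, or_false, exists_eq_or_imp, exists_eq_left, h₀, h₁,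
      h₂, h₃, onlySend_val _ _ _]
    rcases ha with rfl | rfl <;> rcases hb with rfl | rfl <;> simp [pauliIndex]
  have h2 : OnlyTau Δ [] (setIndex c₀ c₁ c₂ c₃ i) C _ _ := h1.restrict_par_val hs (stable_cond hst)
    (by simp) (by simpa [Stack.vars] using hi) (by simpa [Stack.vars] using hi')
  refine .det (h2.det_evalCtx (.restrict (.par (stable_cond hst) (.act _ _)))
    (hE.seq R).scope) ?_
  have h3 : OnlyTerm Δ [] _ _ _ _ := (onlyTerm_par_fin (Δ := Δ) (Γ := []) (C := { C with
    stack := .fork C.stack (.push [] .empty) (.push [] .empty),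
    val := Function.update C.val i (some (pauliIndex a b)) }) rfl).restrict [gateR]
  refine .det (((h3.scope hC).seq R).det_evalCtx (.seq (.scope (.restrict (.par .fin .fin)))) hE) ?_
  have h4 := Ctx.drop_nil { C with
    stack := .fork C.stack (.push [] .empty) (.push [] .empty),
    val := Function.update C.val i (some (pauliIndex a b)) } C.stack
  simp only [Stack.vars, List.append_nil, h4]
  exact h

theorem post_scope_nil {C : Ctx} {e : Frame} {s : Stack} (hC : C.stack = .push e s) :
    Post Δ ⟨.scope .nil, .pure C⟩ := by
  refine .det ((onlyTau_scopeNil hC).det (.scope .nil)) (.stuck ?_)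
  rintro T (⟨α, C', h, h'⟩ | ⟨p, h⟩)
  · exact not_step_nil h'
  · exact Stable.nil.not_ptrans _ _ h

theorem sends_scope {C : Ctx} {e : Frame} {s : Stack} {x : Var} (hC : C.stack = .push e s)
    (hx : C.qubits = [x]) (hv : C.val x = none) (hω : C.rho = mem1 x ω) :
    Sends Δ ω ⟨.scope (.act (.send gateH (.var x)) .nil), .pure C⟩ := by
  refine ⟨(Stable.scope (.act _ _)).not_ptrans, x, ⟨.scope .nil, .pure C⟩, ?_, ?_,
    post_scope_nil hC⟩
  · have h1 : ∀ α Q D, Step Δ [] (.act (.send gateH (.var x)) .nil) C α Q D ↔ _ :=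
      fun α Q D => step_send_qubit_iff (by simp [hx]) hv
    rintro α ⟨Q, D⟩
    have h2 := (IsEvalCtx.id.scope).step_iff (Δ := Δ) (Γ := []) (C := C)
      (P := .act (.send gateH (.var x)) .nil) (by simp)
      (fun P' D h => by cases ((h1 _ _ _).1 h).1) α Q D
    constructor
    · rintro ⟨_, h, h'⟩
      cases h
      obtain ⟨P', h3, h4⟩ := h2.1 h'
      obtain ⟨rfl, rfl, rfl⟩ := (h1 _ _ _).1 h4
      exact ⟨rfl, by rw [h3]⟩
    · rintro ⟨rfl, h⟩
      cases h
      exact ⟨C, rfl, h2.2 ⟨_, rfl, (h1 _ _ _).2 ⟨rfl, rfl, rfl⟩⟩⟩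
  · simp only [State.qubitState, Ctx.qubitState, hx, hω, Option.some.injEq]
    ext i j
    simp [Memory.traceList, mem1]

theorem receives_evalCtx {L : Density → Set State} (hE : IsEvalCtx Δ E) {C : Ctx} {x : Var}
    {P : Proc} (hx : (x, Ty.nat) ∉ C.stack.vars) (hx' : (x, Ty.qubit) ∈ C.stack.vars)
    (hq : C.qubits = []) (hr : C.rho = emptyCtx.rho)
    (h : ∀ ν : Density, ⟨E P, .pure { C with qubits := [x], rho := mem1 x ν.1 }⟩ ∈
      Mid Δ (L ν) (hadamardConj ν.1)) :
    Receives Δ L ⟨E (.act (.recv gateG x) P), .pure C⟩ := by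
  refine ⟨(hE.stable (.act _ _)).not_ptrans, x,
    fun ν => ⟨E P, .pure { C with qubits := [x], rho := mem1 x ν.1 }⟩, ?_, fun ν => ⟨h ν, ?_⟩⟩
  · have h1 : ∀ α Q D, Step Δ [] (.act (.recv gateG x) P) C α Q D ↔ ∃ ν : Density,
        α = .recvQubit gateG x ∧ Q = P ∧ D = .pure { C with qubits := [x], rho := mem1 x ν.1 } := by
      intro α Q D
      rw [step_recv_qubit_iff (by simpa using hx) (by simpa using hx') (by simp [hq])]
      simp only [hq, hr, addQubit_emptyCtx]
    rintro α ⟨Q, D⟩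
    have h2 := hE.step_iff (Γ := []) (C := C) (P := .act (.recv gateG x) P) (by simp)
      (fun P' D h => by obtain ⟨_, h, _⟩ := (h1 _ _ _).1 h; cases h) α Q D
    constructor
    · rintro ⟨_, h, h'⟩
      cases h
      obtain ⟨P', h3, h4⟩ := h2.1 h'
      obtain ⟨ν, rfl, rfl, rfl⟩ := (h1 _ _ _).1 h4
      exact ⟨ν, rfl, by rw [h3]⟩
    · rintro ⟨ν, rfl, h⟩
      cases h
      exact ⟨C, rfl, h2.2 ⟨_, rfl, (h1 _ _ _).2 ⟨ν, rfl, rfl, rfl⟩⟩⟩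
  · simp only [State.qubitState, Ctx.qubitState, Option.some.injEq]
    ext i j
    simp [Memory.traceList, mem1]

end

/-! ### The correction of a Pauli operator -/

/-- The context with the variables `y` and `i`, where `y` has the state `ω` and `i` the value `k`. -/
def pauliCtx (ω : Matrix (Fin 2) (Fin 2) ℂ) (k : ℤ) : Ctx where
  stack := .push [(.prog vY, .qubit), (.prog vI, .nat)] .empty
  qubits := [.prog vY]
  rho := mem1 (.prog vY) ω
  val := Function.update (fun _ => none) (.prog vI) (some k)

/-- The emission of the output. -/
def outputProc : Proc := .act (.send gateH (.var (.prog vY))) .nil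

/-- The state before the correction of the Pauli operator which multiplies `X` by `a` and `Z` by `b`. -/
def loopState (ω : Matrix (Fin 2) (Fin 2) ℂ) (a b : ℤ) : State :=
  ⟨.scope (.seq (.call sigma [.prog vI, .prog vY]) outputProc),
    .pure (pauliCtx (pauliConj a b ω) (pauliIndex a b))⟩

/-- The states before the correction of a Pauli operator other than the identity. -/
def loopStates (ω : Matrix (Fin 2) (Fin 2) ℂ) : Set State :=
  {S | ∃ a b, IsSign a ∧ IsSign b ∧ ¬ (a = 1 ∧ b = 1) ∧ S = loopState ω a b}

theorem basisState_zero : basisState 0 = obsProj pauliZ.1 1 := by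
  rw [obsProj_pauliZ]
  ext i j; fin_cases i <;> fin_cases j <;> simp [basisState]

theorem trace_pauliZ : pauliZ.1.trace = 0 := by simp [pauliZ, Matrix.trace, Fin.sum_univ_two]

theorem trace_pauliX : pauliX.1.trace = 0 := by simp [pauliX, Matrix.trace, Fin.sum_univ_two]

theorem trace_pauliX_mul_obsProj (τ : ℂ) : (pauliX.1 * obsProj pauliZ.1 τ).trace = 0 := by
  rw [obsProj_pauliZ, pauliX_val, Matrix.mul_fin_two]
  simp [Matrix.trace, Fin.sum_univ_two]

theorem stable_sigmaBody (i y : Var) : ∀ w ∈ [(Cond.eq i 0, Proc.fin),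
    (.eq i 1, pauliStep pauliX pauliZ.neg i y), (.eq i 2, pauliStep pauliX.neg pauliZ.neg i y),
    (.eq i 3, pauliStep pauliX.neg pauliZ i y)], Stable hadDefs w.2 := by
  simp only [List.mem_cons, List.not_mem_nil, or_false]
  rintro w (rfl | rfl | rfl | rfl)
  · exact .fin
  all_goals exact .seq (.decl _ _)

theorem stable_call_sigma (i y : Var) : Stable hadDefs (.call sigma [i, y]) :=
  .call (stable_cond (stable_sigmaBody i y))

theorem step_call_sigma_iff {Γ : Frame} {ω : Matrix (Fin 2) (Fin 2) ℂ} {k : ℤ} {α : Label}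
    {Q : Proc} {D : PCtx} : Step hadDefs Γ (.call sigma [.prog vI, .prog vY]) (pauliCtx ω k) α Q D ↔
      (k = 0 ∧ Step hadDefs Γ .fin (pauliCtx ω k) α Q D) ∨
      (k = 1 ∧ Step hadDefs Γ (pauliStep pauliX pauliZ.neg (.prog vI) (.prog vY))
        (pauliCtx ω k) α Q D) ∨
      (k = 2 ∧ Step hadDefs Γ (pauliStep pauliX.neg pauliZ.neg (.prog vI) (.prog vY))
        (pauliCtx ω k) α Q D) ∨
      (k = 3 ∧ Step hadDefs Γ (pauliStep pauliX.neg pauliZ (.prog vI) (.prog vY))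
        (pauliCtx ω k) α Q D) := by
  rw [step_call_iff]
  refine (step_cond_iff (stable_sigmaBody _ _)).trans ?_
  simp [Cond.Holds, pauliCtx]

theorem tree_loopState_one {L : Set State} (ω : Matrix (Fin 2) (Fin 2) ℂ) :
    Tree hadDefs L ω 1 (loopState ω 1 1) := by
  have h1 : OnlyTerm hadDefs [] (.call sigma [.prog vI, .prog vY])
      (pauliCtx (pauliConj (1 : ℤ) (1 : ℤ) ω) (pauliIndex 1 1)) .nil
      (pauliCtx (pauliConj (1 : ℤ) (1 : ℤ) ω) (pauliIndex 1 1)) := by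
    intro α Q D
    rw [step_call_sigma_iff]
    simp [pauliIndex, onlyTerm_fin _ _ _]
  refine .det ((h1.seq outputProc).det_evalCtx (.seq (stable_call_sigma _ _)) IsEvalCtx.id.scope)
    (.sends (sends_scope (x := .prog vY) rfl rfl ?_ ?_))
  · simp [pauliCtx]
  · simp only [pauliCtx]
    congr 1
    ext i j; fin_cases i <;> fin_cases j <;> simp [pauliConj]

theorem tree_loopState {ω : Matrix (Fin 2) (Fin 2) ℂ} {a b : ℤ} (ha : IsSign a) (hb : IsSign b) :
    Tree hadDefs (loopStates ω) ω (if a = 1 ∧ b = 1 then 1 else 0) (loopState ω a b) := by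
  split_ifs with h
  · rw [h.1, h.2]; exact tree_loopState_one ω
  · exact .loop ⟨a, b, ha, hb, h, rfl⟩

theorem transferState_smul (a b m n : ℂ) (O₀ O₁ : Matrix (Fin 2) (Fin 2) ℂ) (F : Op2) :
    transferState (a • O₀) (b • O₁) m n F = transferState O₀ O₁ (a * m) (b * n) F := by
  simp only [transferState, transferHalf, smul_pairProj, smul_obsProj]

theorem IsSign.mul {a b : ℤ} (ha : IsSign a) (hb : IsSign b) : IsSign (a * b) := by
  rcases ha with rfl | rfl <;> rcases hb with rfl | rfl <;> simp [IsSign]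

/-- The body of `pauliStep`, after the declaration of the variables. -/
theorem tree_pauliStep {ω : Matrix (Fin 2) (Fin 2) ℂ} (hω : ω.trace = 1) {a b : ℤ}
    (ha : IsSign a) (hb : IsSign b) {O₀ O₁ : Observable} (h₀ : O₀.1 = (a : ℂ) • pauliX.1)
    (h₁ : O₁.1 = (b : ℂ) • pauliZ.1) :
    ∃ T : Proc × PCtx, OnlyTau hadDefs [] (pauliStep O₀ O₁ (.prog vI) (.prog vY))
        (pauliCtx (pauliConj a b ω) (pauliIndex a b)) T.1 T.2 ∧
      Tree hadDefs (loopStates ω) ω (1 / 4) ⟨.scope (.seq T.1 outputProc), T.2⟩ := by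
  refine ⟨⟨_, _⟩, (onlyTau_decl _ _).evalCtx (IsEvalCtx.id.seq _), ?_⟩
  have hE₁ : IsEvalCtx hadDefs fun P => .scope (.seq P outputProc) :=
    IsEvalCtx.id.scope.seq _
  have hE := (hE₁.seq (.call sigma [.prog vI, .prog vY])).scope
  refine tree_init hE rfl (by simp [Stack.vars, pauliCtx]) (by simp [Stack.vars, pauliCtx])
    (by simp [pauliCtx]) ?_
  have h1 : (mem1 (.prog vY) (pauliConj a b ω)).addQubit (.prog vZ) (basisState 0) =
      mem2 (.prog vY) (.prog vZ) (pauliConj a b ω ⊗ₖ obsProj pauliZ.1 1) := by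
    rw [addQubit_mem1, basisState_zero]
  have e : (1 / 4 : ℝ) = (((1 / 4 + 1 / 4) / 2 + (1 / 4 + 1 / 4) / 2) / 2) := by norm_num
  rw [e]
  refine tree_transfer (p := fun _ _ => 1 / 4) (x := vY) (y := vZ) (m := vM) (n := vN) hE rfl
    (by decide) (.inr rfl) (by simp [pauliCtx]) (by simp [Stack.vars, pauliCtx])
    (by simp [Stack.vars, pauliCtx]) (by simp [Stack.vars, pauliCtx])
    (by simp [Stack.vars, pauliCtx]) h1 ?_ ?_ ?_
  · intro m hm
    exact trace_pairProj pauliX.2.1 pauliX.2.2 (by simp) hm.mul_self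
      (by rw [trace_pauliConj, hω]) (trace_obsProj trace_pauliZ _) (trace_pauliX_mul_obsProj _)
  · intro m n hm hn
    rw [transferState_pauli hm.mul_self hn.mul_self (by norm_num), Matrix.trace_kronecker,
      trace_obsProj trace_pauliZ, trace_pauliConj, trace_pauliConj, hω, one_mul]
  intro m n hm hn
  rw [transferState_pauli hm.mul_self hn.mul_self (by norm_num), mem2_swap, mul_one,
    pauliConj_pauliConj hn.mul_self hb.mul_self]
  have e : (1 / 4 : ℝ) = (((if m * 1 = 1 ∧ (1 : ℤ) = 1 then (1 : ℝ) else 0) +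
      (if m * 1 = 1 ∧ (-1 : ℤ) = 1 then (1 : ℝ) else 0)) / 2 +
      ((if m * (-1) = 1 ∧ (1 : ℤ) = 1 then (1 : ℝ) else 0) +
      (if m * (-1) = 1 ∧ (-1 : ℤ) = 1 then (1 : ℝ) else 0)) / 2) / 2 := by
    rcases hm with rfl | rfl <;> norm_num
  rw [e]
  refine tree_transfer (p := fun m' n' => if m * m' = 1 ∧ n' = 1 then 1 else 0)
    (x := vZ) (y := vY) (m := vM') (n := vN') hE rfl
    (by decide) (.inl rfl) (by simp [pauliCtx]) (by simp [Stack.vars, pauliCtx])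
    (by simp [Stack.vars, pauliCtx]) (by simp [Stack.vars, pauliCtx])
    (by simp [Stack.vars, pauliCtx]) rfl ?_ ?_ ?_
  · intro m' hm'
    exact trace_pairProj O₀.2.1 O₀.2.2 (by simp) hm'.mul_self
      (by rw [trace_pauliConj, hω]) (trace_obsProj trace_pauliZ _) (trace_pauliX_mul_obsProj _)
  · intro m' n' hm' hn'
    have h2 := (ha.mul hm').mul_self
    have h3 := (hb.mul hn').mul_self
    push_cast at h2 h3
    rw [h₀, h₁, transferState_smul, transferState_pauli h2 h3 hn.mul_self, Matrix.trace_kronecker,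
      trace_obsProj trace_pauliZ, trace_pauliConj, trace_pauliConj, hω, one_mul]
  intro m' n' hm' hn'
  have h2 := (ha.mul hm').mul_self
  have h3 := (hb.mul hn').mul_self
  have h4 := ((hb.mul hn').mul hn).mul_self
  have h5 := (hn.mul hb).mul_self
  push_cast at h2 h3 h4 h5
  rw [h₀, h₁, transferState_smul, transferState_pauli h2 h3 hn.mul_self,
    pauliConj_pauliConj h4 h5,
    show (a : ℂ) * m' * (m * a) = ((m * m' : ℤ) : ℂ) * (a * a) by push_cast; ring,
    show (b : ℂ) * n' * n * (n * b) = (n' : ℂ) * (n * n) * (b * b) by ring,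
    ha.mul_self, hb.mul_self, hn.mul_self, mul_one, mul_one, mul_one]
  refine tree_setIndex (a := m * m') (b := n') hE₁ rfl (by simp [Stack.vars, pauliCtx])
    (by simp [Stack.vars, pauliCtx]) (hm.mul hm') hn' ?_ ?_ ?_ ?_ ?_
  · rcases hm with rfl | rfl <;> rcases hm' with rfl | rfl <;> rcases hn' with rfl | rfl <;>
      simp [prodBoth, both, Cond.Holds]
  · rcases hm with rfl | rfl <;> rcases hm' with rfl | rfl <;> rcases hn' with rfl | rfl <;>
      simp [prodBoth, both, Cond.Holds]
  · rcases hm with rfl | rfl <;> rcases hm' with rfl | rfl <;> rcases hn' with rfl | rfl <;>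
      simp [prodBoth, both, Cond.Holds]
  · rcases hm with rfl | rfl <;> rcases hm' with rfl | rfl <;> rcases hn' with rfl | rfl <;>
      simp [prodBoth, both, Cond.Holds]
  convert tree_loopState (ω := ω) (hm.mul hm') hn' using 1
  rw [loopState]
  congr 2
  simp only [Ctx.drop, pauliCtx, Ctx.mk.injEq, true_and]
  refine ⟨by simp, ?_, ?_⟩
  · simp only [List.map_cons, List.map_nil, List.mem_cons, Var.prog.injEq, List.not_mem_nil,
      List.filter_cons, List.filter_nil]
    norm_num
    rw [Memory.traceList, List.foldr_cons, List.foldr_nil, traceOut_mem2 (by decide),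
      trace_obsProj trace_pauliZ, one_smul]
  · funext z
    rcases z with z | z
    · simp [Function.update_apply]
      grind
    · simp

theorem isLoop_loopStates {ω : Matrix (Fin 2) (Fin 2) ℂ} (hω : ω.trace = 1) :
    IsLoop hadDefs (loopStates ω) ω := by
  rintro _ ⟨a, b, ha, hb, hab, rfl⟩
  have key : ∀ O₀ O₁ : Observable, O₀.1 = (a : ℂ) • pauliX.1 → O₁.1 = (b : ℂ) • pauliZ.1 →
      (∀ α Q D, Step hadDefs [] (.call sigma [.prog vI, .prog vY])
          (pauliCtx (pauliConj a b ω) (pauliIndex a b)) α Q D ↔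
        Step hadDefs [] (pauliStep O₀ O₁ (.prog vI) (.prog vY))
          (pauliCtx (pauliConj a b ω) (pauliIndex a b)) α Q D) →
      ∃ T, Det hadDefs (loopState ω a b) T ∧ Tree hadDefs (loopStates ω) ω (1 / 4) T := by
    intro O₀ O₁ h₀ h₁ h
    obtain ⟨T, h2, h3⟩ := tree_pauliStep hω ha hb h₀ h₁
    have h4 : OnlyTau hadDefs [] (.call sigma [.prog vI, .prog vY])
        (pauliCtx (pauliConj a b ω) (pauliIndex a b)) T.1 T.2 := fun α Q D =>
      (h α Q D).trans (h2 α Q D)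
    exact ⟨_, h4.det_evalCtx (stable_call_sigma _ _) (IsEvalCtx.id.scope.seq outputProc), h3⟩
  rcases ha with rfl | rfl <;> rcases hb with rfl | rfl
  · exact (hab ⟨rfl, rfl⟩).elim
  · refine key pauliX pauliZ.neg (by simp) (by simp [Observable.neg]) fun α Q D => ?_
    rw [step_call_sigma_iff]; simp [pauliIndex]
  · refine key pauliX.neg pauliZ (by simp [Observable.neg]) (by simp) fun α Q D => ?_
    rw [step_call_sigma_iff]; simp [pauliIndex]
  · refine key pauliX.neg pauliZ.neg (by simp [Observable.neg]) (by simp [Observable.neg])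
      fun α Q D => ?_
    rw [step_call_sigma_iff]; simp [pauliIndex]

/-! ### The initial states -/

/-- The loops of the simulation, for each input. -/
def simulLoops (ν : Density) : Set State := loopStates (hadamardConj ν.1)

theorem trace_hadamardConj_density (ν : Density) : (hadamardConj ν.1).trace = 1 := by
  rw [trace_hadamardConj, ν.2.2]

theorem isLoop_simulLoops (ν : Density) : IsLoop hadDefs (simulLoops ν) (hadamardConj ν.1) :=
  isLoop_loopStates (trace_hadamardConj_density ν)

theorem pre_simulHad : Pre hadDefs simulLoops (initState simulHad) := by
  refine .det ((onlyTau_decl _ _).det (.decl _ _)) ?_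
  have hE₁ : IsEvalCtx hadDefs fun P => .scope (.seq P
    (.seq (.call sigma [.prog vI, .prog vY]) outputProc)) := IsEvalCtx.id.scope.seq _
  refine .det ((onlyTau_decl _ _).det_evalCtx (.decl _ _) hE₁) (.recv ?_)
  have hE := hE₁.scope
  refine receives_evalCtx hE (by simp [Stack.vars, emptyCtx]) (by simp [Stack.vars, emptyCtx])
    rfl rfl fun ν => ⟨1 / 4, ?_⟩
  refine tree_init hE rfl (by simp [Stack.vars, emptyCtx]) (by simp [Stack.vars, emptyCtx])
    (by simp) ?_
  have h1 : (mem1 (.prog vX) ν.1).addQubit (.prog vY) (basisState 0) =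
      mem2 (.prog vX) (.prog vY) (ν.1 ⊗ₖ obsProj pauliZ.1 1) := by
    rw [addQubit_mem1, basisState_zero]
  have e : (1 / 4 : ℝ) = (((if (1 : ℤ) = 1 ∧ (1 : ℤ) = 1 then (1 : ℝ) else 0) +
      (if (1 : ℤ) = 1 ∧ (-1 : ℤ) = 1 then (1 : ℝ) else 0)) / 2 +
      ((if (-1 : ℤ) = 1 ∧ (1 : ℤ) = 1 then (1 : ℝ) else 0) +
      (if (-1 : ℤ) = 1 ∧ (-1 : ℤ) = 1 then (1 : ℝ) else 0)) / 2) / 2 := by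
    norm_num
  rw [e]
  refine tree_transfer (p := fun m n => if m = 1 ∧ n = 1 then 1 else 0)
    (x := vX) (y := vY) (m := vM) (n := vN) hE rfl
    (by decide) (.inr rfl) (by simp [emptyCtx]) (by simp [Stack.vars, emptyCtx])
    (by simp [Stack.vars, emptyCtx]) (by simp [Stack.vars, emptyCtx])
    (by simp [Stack.vars, emptyCtx]) h1 ?_ ?_ ?_
  · intro m hm
    exact trace_pairProj pauliZ.2.1 pauliZ.2.2 (by simp) hm.mul_self
      ν.2.2 (trace_obsProj trace_pauliZ _) (trace_pauliX_mul_obsProj _)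
  · intro m n hm hn
    rw [transferState_hadamard hm.mul_self hn.mul_self, Matrix.trace_kronecker,
      trace_obsProj trace_pauliX, trace_pauliConj, trace_hadamardConj_density, one_mul]
  intro m n hm hn
  rw [transferState_hadamard hm.mul_self hn.mul_self]
  refine tree_setIndex (a := m) (b := n) IsEvalCtx.id.scope rfl (by simp [Stack.vars, emptyCtx])
    (by simp [Stack.vars, emptyCtx]) hm hn ?_ ?_ ?_ ?_ ?_
  iterate 4
    simp [both, Cond.Holds]
  change Tree hadDefs (loopStates (hadamardConj ν.1)) _ _ _
  convert tree_loopState (ω := hadamardConj ν.1) hm hn using 1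
  rw [loopState]
  congr 2
  simp only [Ctx.drop, pauliCtx, Ctx.mk.injEq]
  refine ⟨rfl, by simp, ?_, ?_⟩
  · simp only [List.map_cons, List.map_nil, List.mem_cons, Var.prog.injEq, List.not_mem_nil,
      List.filter_cons, List.filter_nil]
    norm_num
    rw [Memory.traceList, List.foldr_cons, List.foldr_nil, traceOut_mem2 (by decide),
      trace_obsProj trace_pauliX, one_smul]
  · funext z
    rcases z with z | z
    · simp [Function.update_apply, emptyCtx]
      grind
    · simp [emptyCtx]

theorem pre_had : Pre hadDefs simulLoops (initState had) := by
  refine .det ((onlyTau_decl _ _).det (.decl _ _)) (.recv ?_)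
  have hE : IsEvalCtx hadDefs fun P => .scope P := IsEvalCtx.id.scope
  refine receives_evalCtx hE (by simp [Stack.vars, emptyCtx]) (by simp [Stack.vars, emptyCtx])
    rfl rfl fun ν => ⟨1, ?_⟩
  set C : Ctx := {
    stack := .push [(.prog vX, .qubit)] .empty
    qubits := [.prog vX]
    rho := mem1 (.prog vX) ν.1
    val := fun _ => none } with hC
  have hf : C.fresh = .res 0 := Ctx.fresh_eq_zero rfl
  refine .det ((onlyTau_expr (C := C) (fun _ _ => evalStep_app_iff (C := C)
    (f := [(.prog vX, .qubit)]) (s := .empty) rfl (by simp [hC])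
    (fun i j _ => Subsingleton.elim i j) (by rw [hf])) (by simp)).det_evalCtx (.act _ _) hE) ?_
  have h1 : C.rho.applyOp (hadamard.op 0) ![.prog vX] = mem1 (.prog vX) (hadamardConj ν.1) := by
    rw [hC, applyOp_mem1, toBit_hadamard, hadamardConj]
  have h2 : C.outcomeProb hadamard ![.prog vX] 0 = 1 := by
    rw [Ctx.outcomeProb, Ctx.trace, Ctx.apply, h1, show C.qubits = [.prog vX] from rfl,
      traceList_mem1, trace_hadamardConj_density, Complex.one_re]
  have h3 : (PCtx.prob (hadamard.outcomes.map fun τ => (C.outcomeProb hadamard ![.prog vX] τ,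
      C.afterOutcome hadamard ![.prog vX] τ [(.prog vX, .qubit)] .empty))) =
      .prob [(1, C.afterOutcome hadamard ![.prog vX] 0 [(.prog vX, .qubit)] .empty)] := by
    exact congrArg (fun q => PCtx.prob [(q, _)]) h2
  rw [h3]
  refine .sure (sure_prob _ _) ?_
  set C' := C.afterOutcome hadamard ![.prog vX] 0 [(.prog vX, .qubit)] .empty with hC'
  refine .det ((onlyTau_expr (C := C') (evalStep_var_of_eq_some (v := 0)
    (by simp [hC', Ctx.afterOutcome])) (by simp)).det_evalCtx (.act _ _) hE) ?_
  refine .det (onlyTau_expr_val.det_evalCtx (.act _ _) hE) ?_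
  refine .sends (sends_scope (x := .prog vX) rfl rfl ?_ ?_)
  · simp only [hC', Ctx.afterOutcome, hf]
    simp [hC]
  · simp [hC', Ctx.afterOutcome, h2, Ctx.apply, h1]

end

end QPAlg

theorem mainTheorem3 :
    ∃ B : QPAlg.State → QPAlg.State → Prop,
      QPAlg.IsBisimulation QPAlg.hadDefs B ∧
      B (QPAlg.initState QPAlg.had) (QPAlg.initState QPAlg.simulHad) ∧
      ∀ P ∈ ({QPAlg.had, QPAlg.simulHad} : Set QPAlg.Proc),
        ∀ (S₁ S₂ S S₃ S₄ : QPAlg.State) (x y : QPAlg.Var),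
          Relation.ReflTransGen (QPAlg.Silent QPAlg.hadDefs) (QPAlg.initState P) S₁ →
          QPAlg.Trans QPAlg.hadDefs S₁ (.recvQubit QPAlg.gateG x) S₂ →
          Relation.ReflTransGen (QPAlg.Silent QPAlg.hadDefs) S₂ S →
          Relation.ReflTransGen (QPAlg.Silent QPAlg.hadDefs) S S₃ →
          QPAlg.Trans QPAlg.hadDefs S₃ (.sendQubit QPAlg.gateH y) S₄ →
          QPAlg.mu QPAlg.hadDefs B S {V | B S₄ V} = 1 := by
  refine ⟨QPAlg.SamePhase QPAlg.hadDefs QPAlg.simulLoops,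
    QPAlg.samePhase_isBisimulation QPAlg.isLoop_simulLoops,
    QPAlg.samePhase_of_mem (c := .pre) QPAlg.pre_had QPAlg.pre_simulHad, ?_⟩
  rintro P (rfl | rfl) S₁ S₂ S S₃ S₄ x y h₁ h₂ h h₃ h₄
  · exact QPAlg.mu_eq_one_of_pre QPAlg.isLoop_simulLoops QPAlg.pre_had h₁ h₂ h h₃ h₄
  · exact QPAlg.mu_eq_one_of_pre QPAlg.isLoop_simulLoops QPAlg.pre_simulHad h₁ h₂ h h₃ h₄
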